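/- **Setting.** Let $K$ be a non-archimedean local field whose residue field has characteristic $\neq 2$, let $\overline K$ be an algebraic closure, and let $\nu\colon\overline K\to\mathbb Q\cup\{\infty\}$ be the extension of the normalised valuation of $K$. An *octad* is an ordered 8-tuple $O=(O_A,\dots,O_H)$ of points of $\mathbb P^3(\overline K)$. It is a *Cayley octad* if its points are exactly the common zeros of three quadrics, and it is *normalised* if some five of its points are $(1:0:0:0),\dots,(0:0:0:1),(1:1:1:1)$. **Valuation data.** Let $P$ be the set of 4-element subsets of $\{A,\dots,H\}$ and $\dagger$ a further symbol. Choose coordinate vectors of the points $O_i$ with minimal coordinate valuation $0$, and put $[ijkl]=\det(O_i|O_j|O_k|O_l)$. The valuation data of $O$ is the function $v\colon P\cup\{\dagger\}\to\mathbb Q$ with $v_S=\nu([ijkl])$ for $S=\{i,j,k,l\}$ and $v_\dagger=\min_\sigma\bigl(\nu(a_\sigma-b_\sigma)-\min(\nu(a_\sigma),\nu(b_\sigma))\bigr)$. Here $\sigma$ runs over the orderings $(x_1,\dots,x_8)$ of the labels, $a_\sigma=[x_1x_2x_3x_7][x_1x_4x_5x_7][x_2x_4x_6x_7][x_3x_5x_6x_7]$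 and $b_\sigma=[x_1x_2x_4x_7][x_1x_3x_5x_7][x_2x_3x_6x_7][x_4x_5x_6x_7]$. It is defined if these values are finite (no four points coplanar, not all eight on a twisted cubic). For a set $T$ of labels let $\mathrm{pt}^T,\ln^T,\mathrm{pln}^T$ take the values $\max(0,|S\cap T|-k)$ at $S\in P$ for $k=1,2,3$ respectively, and $0$ at $\dagger$. Let $\mathrm{tc}$ be $1$ at $\dagger$ and $0$ on $P$. Sums and maxima are componentwise. **Building blocks**, up to relabelling, each followed by the data that determine its *picture*. Blocks in the same item have the same picture. * $\alpha_1$: $\mathrm{pt}^{AB}$; $\mathrm{pln}^{CDEFGH}$. Picture: the pair $AB$. * $\alpha_2$: $\mathrm{pln}^{ABCD}+\mathrm{pln}^{EFGH}$; $\mathrm{pln}^{ABCD}+\mathrm{pt}^{ABCD}$. Picture: the unordered partition $ABCD|EFGH$. * $\chi_1$: $\max(\ln^{CDE}+\ln^{FGH},\mathrm{pln}^{CDEFGH})$; $\max(\mathrm{pt}^{AB},\mathrm{pln}^{ABCDE}+\mathrm{pln}^{ABFGH})$; $\max(\ln^{ABCDE}+\ln^{CDE},\mathrm{pt}^{CDE})$.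 Picture: the pair $AB$ and the unordered pair of triples $CDE,FGH$. * $\chi_2$: $\ln^{DEFGH}+\mathrm{pln}^{DEFGH}$; $\ln^{ABC}+\mathrm{pt}^{ABC}$; $\ln^{ABC}+\mathrm{pln}^{DEFGH}$. Picture: the triple $ABC$. * $\phi_1$: $\ln^{ABEF}+\ln^{ABGH}+\mathrm{pln}^{ABCD}+\mathrm{pln}^{EFGH}$; $\max(\mathrm{pt}^{AB}+\mathrm{pt}^{CD},\mathrm{pln}^{ABCDEF}+\mathrm{pln}^{ABCDGH})$. Picture: $\{\{AB,CD\},\{EF,GH\}\}$. * $\phi_2$: $\max(\ln^{ABC}+\ln^{FGH},\mathrm{pln}^{ABCDE}+\mathrm{pln}^{DEFGH})$; $\mathrm{pt}^{DE}+\ln^{ABCD}+\ln^{ABCE}$; $\ln^{ABCD}+\ln^{ABCE}+\mathrm{pln}^{ABCFGH}$. Picture: $\{ABC,FGH\}$. * $\phi_3$: $\ln^{ABCD}+\mathrm{pln}^{ABCD}+\mathrm{pln}^{EFGH}$; $\mathrm{pt}^{ABCD}+\ln^{ABCD}+\mathrm{pln}^{ABCD}$. Picture: $\{ABCD,EFGH\}$.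 * $\mathbf{TCu}$: $\mathrm{tc}$. One picture. * $\mathbf{Line}$: $\ln^{ABCD}$. Picture: the unordered partition $ABCD|EFGH$. *Auxiliary blocks*, with pictures indexed as above: * for $\phi_1$ with picture $\{\{AB,CD\},\{EF,GH\}\}$: the blocks with picture $\alpha_2^{ABCD}$, $\mathbf{Line}^{ABEF}$ or $\mathbf{Line}^{ABGH}$; * for $\phi_2$ with picture $\{ABC,FGH\}$: $\alpha_1^{DE}$, $\mathbf{Line}^{ABCD}$ or $\mathbf{Line}^{ABCE}$; * for $\phi_3$ with picture $\{ABCD,EFGH\}$: $\alpha_2^{ABCD}$, $\mathbf{Line}^{ABCD}$ or $\mathbf{TCu}$. **Compatibility.** Two blocks are compatible if their pictures are equal or form, up to relabelling and order, one of the following pairs. (Write $\alpha_2^{T}$, $\mathbf{Line}^T$ and $\phi_3^T$ with $|T|=4$ for the partition $T|T^c$; $\chi_1^{T|U}$ has triples $T,U$; $\phi_2^{T|U}$ likewise; $\phi_1$ stands for $\{\{HA,DE\},\{BC,FG\}\}$.) * $\alpha_1^{HA},\alpha_1^{BC}$; $\ \alpha_1^{HA},\alpha_2^{HABC}$; $\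 \alpha_2^{FGHA},\alpha_2^{HABC}$; * $\chi_1^{CDE|FGH}$ with $\alpha_1^{AB}$, $\alpha_1^{CD}$, $\alpha_2^{BCDE}$ or $\alpha_2^{HABC}$; $\ \chi_2^{BCD}$ with $\alpha_1^{BC}$, $\alpha_1^{HA}$ or $\alpha_2^{BCDE}$; * $\chi_1^{BCD|EFG},\chi_1^{DEF|GHA}$; $\ \chi_1^{BCD|EFG},\chi_2^{BCD}$; $\ \chi_2^{CDE},\chi_2^{FGH}$; * $\phi_1$ with $\alpha_1^{HA}$, $\alpha_2^{GHAB}$ or $\chi_1^{BCD|EFG}$; $\ \phi_2^{CDE|FGH}$ with $\alpha_1^{CD}$, $\alpha_2^{EFGH}$ or $\chi_2^{FGH}$; $\ \phi_2^{GHA|BCD},\chi_1^{BCD|EFG}$; $\ \phi_3^{HABC},\alpha_1^{HA}$; $\ \phi_3^{BCDE},\chi_2^{BCD}$; * $\mathbf{TCu}$ with $\alpha_1^{AB}$ or $\chi_2^{ABC}$; $\ \mathbf{Line}^{ABCD}$ with $\alpha_1^{AB}$, $\alpha_2^{BCDE}$, $\chi_1^{CDE|FGH}$ or $\chi_2^{ABC}$.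 **Octad pictures.** A *compatible block decomposition* of $v$ is an expression $v=\sum_i m_iB_i+\sum_j l_jb_j$ (finite sums) with rational $m_i>0$ and $l_j\ge 0$, with pairwise compatible building blocks $B_i$, and with blocks $b_j$ that are each auxiliary to some $\phi$-block among the $B_i$ and all have the same picture. Its picture is the overlay (the set) of the pictures of the $B_i$. The *octad picture* $d_K(O)$ is the picture of the compatible block decomposition of the valuation data of $O$; it is defined when such a decomposition exists and all of them have the same picture. **Theorem.** Let $O$ and $O'$ be two normalised Cayley octads over $\overline K$ that coincide (as ordered octads) under the action of $\mathrm{PGL}_3(\overline K)$. Then $d_K(O)=d_K(O')$; in particular one side is defined if and only if the other is. More precisely, a picture is the picture of a compatible block decomposition of the valuation data of $O$ if and only if it is the picture of one for $O'$. -/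

import Mathlib

open scoped LinearAlgebra.Projectivization
open ValuativeRel

namespace CayleyOctad

/-! Throughout, the eight labels `A, B, C, D, E, F, G, H` are the elements `0, 1, …, 7`
of `Fin 8`. -/

/-! ### Octads -/

section Octads

variable {F : Type*} [Field F]

/-- An octad: an ordered `8`-tuple of points of projective `3`-space. -/
abbrev Octad (F : Type*) [Field F] : Type _ := Fin 8 → ℙ F (Fin 4 → F)

/-- A Cayley octad: its points are the common zeros of three quadrics. -/
def IsCayley (O : Octad F) : Prop :=
  ∃ Q : Fin 3 → QuadraticForm F (Fin 4 → F),
    Set.range O = {P : ℙ F (Fin 4 → F) | ∀ j, Q j P.rep = 0}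

/-- The standard projective frame `(1:0:0:0), …, (0:0:0:1), (1:1:1:1)`. -/
def standardFrame (F : Type*) [Field F] : Fin 5 → Fin 4 → F :=
  ![![1, 0, 0, 0], ![0, 1, 0, 0], ![0, 0, 1, 0], ![0, 0, 0, 1], ![1, 1, 1, 1]]

/-- A normalised octad: some five of its points are in standard position. -/
def IsNormalised (O : Octad F) : Prop :=
  ∃ s : Fin 5 ↪ Fin 8, ∀ i, ∃ h : standardFrame F i ≠ 0,
    O (s i) = Projectivization.mk F (standardFrame F i) h

/-- Two (ordered) octads coincide under the action of `PGL₃`, i.e. under an invertible linear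
change of the four homogeneous coordinates. -/
def PGLEquivalent (O O' : Octad F) : Prop :=
  ∃ g : LinearMap.GeneralLinearGroup F (Fin 4 → F), ∀ i, O' i = g • O i

end Octads

/-! ### Valuation data -/

/-- `4`-element subsets of the set of labels. -/
abbrev Quad : Type := {S : Finset (Fin 8) // S.card = 4}

/-- Valuation data: rational-valued functions on the set of `4`-element subsets of the labels
(`some S`) together with one more symbol `†` (`none`). Sums, rational multiples and maxima
`⊔` are componentwise. -/
abbrev ValData : Type := Option Quad → ℚ

section ValuationData

variable {F : Type*} [Field F]

/-- `ν` is the extension to `Kbar` of the normalised valuation of the local field `K`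
(it is unique): it is non-negative on `K` precisely at the integers of `K`, and it takes the
value `1` at the uniformisers of `K`. -/
def IsNormalisedExtension (K : Type*) [Field K] [ValuativeRel K]
    {Kbar : Type*} [Field Kbar] [Algebra K Kbar] (ν : AddValuation Kbar (WithTop ℚ)) : Prop :=
  (∀ x : K, 0 ≤ ν (algebraMap K Kbar x) ↔ x ∈ 𝒪[K]) ∧
    ∀ ϖ : 𝒪[K], Irreducible ϖ → ν (algebraMap K Kbar (ϖ : K)) = 1

/-- `x` consists of coordinate vectors of the points of `O`, scaled such that the minimal
valuation of the coordinates of each point is `0`. -/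
def IsNormalisedLift (ν : AddValuation F (WithTop ℚ)) (O : Octad F)
    (x : Fin 8 → Fin 4 → F) : Prop :=
  ∀ i, (∃ h : x i ≠ 0, Projectivization.mk F (x i) h = O i) ∧
    (∀ j, 0 ≤ ν (x i j)) ∧ ∃ j, ν (x i j) = 0

/-- The bracket `[i j k l] = det (xᵢ | xⱼ | xₖ | xₗ)`. -/
def bracket (x : Fin 8 → Fin 4 → F) (i j k l : Fin 8) : F :=
  Matrix.det (Matrix.of fun r c => x (![i, j, k, l] c) r)

/-- The Plücker coordinate of a `4`-element set of labels, taken in increasing order. -/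
def plucker (x : Fin 8 → Fin 4 → F) (S : Quad) : F :=
  Matrix.det (Matrix.of fun r c => x (S.1.orderEmbOfFin S.2 c) r)

/-- First term of the polynomial expressing that the six points with labels
`σ 0, …, σ 5`, projected from the point with label `σ 6`, lie on a conic. -/
def cubicTermLeft (x : Fin 8 → Fin 4 → F) (σ : Equiv.Perm (Fin 8)) : F :=
  bracket x (σ 0) (σ 1) (σ 2) (σ 6) * bracket x (σ 0) (σ 3) (σ 4) (σ 6) *
    bracket x (σ 1) (σ 3) (σ 5) (σ 6) * bracket x (σ 2) (σ 4) (σ 5) (σ 6)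

/-- Second term of the same polynomial. -/
def cubicTermRight (x : Fin 8 → Fin 4 → F) (σ : Equiv.Perm (Fin 8)) : F :=
  bracket x (σ 0) (σ 1) (σ 3) (σ 6) * bracket x (σ 0) (σ 2) (σ 4) (σ 6) *
    bracket x (σ 1) (σ 2) (σ 5) (σ 6) * bracket x (σ 3) (σ 4) (σ 5) (σ 6)

/-- `t` is the twisted cubic index of an octad with normalised lift `x`: the minimum, over the
polynomials `cubicTermLeft x σ - cubicTermRight x σ` (there are `840` of them up to sign; they
all vanish at eight points of a twisted cubic), of the gap between the valuation of the
polynomial and the smaller of the valuations of its two terms. -/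
def IsTwistedCubicIndex (ν : AddValuation F (WithTop ℚ)) (x : Fin 8 → Fin 4 → F) (t : ℚ) : Prop :=
  (∀ σ : Equiv.Perm (Fin 8),
    (t : WithTop ℚ) + min (ν (cubicTermLeft x σ)) (ν (cubicTermRight x σ)) ≤
      ν (cubicTermLeft x σ - cubicTermRight x σ)) ∧
  ∃ σ : Equiv.Perm (Fin 8),
    (t : WithTop ℚ) + min (ν (cubicTermLeft x σ)) (ν (cubicTermRight x σ)) =
      ν (cubicTermLeft x σ - cubicTermRight x σ)

/-- `v` is the valuation data of the octad `O`. (It does not depend on the lift `x`; it exists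
only if no four points are coplanar and the eight points do not lie on a twisted cubic.) -/
def IsValuationData (ν : AddValuation F (WithTop ℚ)) (O : Octad F) (v : ValData) : Prop :=
  ∃ x : Fin 8 → Fin 4 → F, IsNormalisedLift ν O x ∧
    (∀ S : Quad, ν (plucker x S) = (v (some S) : WithTop ℚ)) ∧
    IsTwistedCubicIndex ν x (v none)

end ValuationData

/-! ### Elementary valuation data -/

/-- The points of `T` coincide (note the truncated subtraction `max 0 (|S ∩ T| - 1)`). -/
def vPt (T : Finset (Fin 8)) : ValData
  | none => 0
  | some S => (((S.1 ∩ T).card - 1 : ℕ) : ℚ)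

/-- The points of `T` lie on a line: `max 0 (|S ∩ T| - 2)`. -/
def vLn (T : Finset (Fin 8)) : ValData
  | none => 0
  | some S => (((S.1 ∩ T).card - 2 : ℕ) : ℚ)

/-- The points of `T` lie on a plane: `max 0 (|S ∩ T| - 3)`. -/
def vPln (T : Finset (Fin 8)) : ValData
  | none => 0
  | some S => (((S.1 ∩ T).card - 3 : ℕ) : ℚ)

/-- The points lie on a twisted cubic. -/
def vTc : ValData
  | none => 1
  | some _ => 0

/-- Relabelling of valuation data by a permutation of the labels. -/
def ValData.relabel (σ : Equiv.Perm (Fin 8)) (v : ValData) : ValData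
  | none => v none
  | some S => v (some ⟨S.1.map σ.symm.toEmbedding, by rw [Finset.card_map]; exact S.2⟩)

/-! ### Pictures of building blocks -/

/-- The picture of one building block, given by its kind and by the marked sets of labels. -/
inductive BlockPicture : Type
  /-- a marked pair -/
  | alpha1 (pair : Finset (Fin 8))
  /-- an unordered partition of the labels into two sets of four -/
  | alpha2 (halves : Finset (Finset (Fin 8)))
  /-- a marked pair, and the other labels in an unordered pair of triples -/
  | chi1 (pair : Finset (Fin 8)) (triples : Finset (Finset (Fin 8)))
  /-- a marked triple -/
  | chi2 (triple : Finset (Fin 8))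
  /-- four pairs, arranged as an unordered pair of unordered pairs -/
  | phi1 (pairs : Finset (Finset (Finset (Fin 8))))
  /-- an unordered pair of triples -/
  | phi2 (triples : Finset (Finset (Fin 8)))
  /-- an unordered partition of the labels into two sets of four -/
  | phi3 (halves : Finset (Finset (Fin 8)))
  /-- all eight points on a twisted cubic -/
  | tcu
  /-- an unordered partition of the labels into two sets of four -/
  | line (halves : Finset (Finset (Fin 8)))

namespace BlockPicture

/-- Relabelling of pictures by a permutation of the labels. -/
def relabel (σ : Equiv.Perm (Fin 8)) : BlockPicture → BlockPicture
  | alpha1 T => alpha1 (T.image σ)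
  | alpha2 π => alpha2 (π.image (Finset.image σ))
  | chi1 T π => chi1 (T.image σ) (π.image (Finset.image σ))
  | chi2 T => chi2 (T.image σ)
  | phi1 π => phi1 (π.image (Finset.image (Finset.image σ)))
  | phi2 π => phi2 (π.image (Finset.image σ))
  | phi3 π => phi3 (π.image (Finset.image σ))
  | tcu => tcu
  | line π => line (π.image (Finset.image σ))

end BlockPicture

/-! ### Building blocks -/

/-- The `19` kinds of building blocks. -/
inductive BlockKind : Type
  | alpha1a | alpha1b
  | alpha2a | alpha2b
  | chi1a | chi1b | chi1c
  | chi2a | chi2b | chi2c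
  | phi1a | phi1b
  | phi2a | phi2b | phi2c
  | phi3a | phi3b
  | tcu
  | line

namespace BlockKind

/-- The valuation data of the standard labelled building block of each kind:
`α₁^{AB}`, `α₂^{ABCD}`, `χ₁^{AB|CDE|FGH}`, `χ₂^{ABC}`, `φ₁^{AB|CD‖EF|GH}`, `φ₂^{ABC|FGH}`,
`φ₃^{ABCD}`, `TCu`, `Line^{ABCD}`. -/
def stdData : BlockKind → ValData
  | alpha1a => vPt {0, 1}
  | alpha1b => vPln {2, 3, 4, 5, 6, 7}
  | alpha2a => vPln {0, 1, 2, 3} + vPln {4, 5, 6, 7}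
  | alpha2b => vPln {0, 1, 2, 3} + vPt {0, 1, 2, 3}
  | chi1a => (vLn {2, 3, 4} + vLn {5, 6, 7}) ⊔ vPln {2, 3, 4, 5, 6, 7}
  | chi1b => vPt {0, 1} ⊔ (vPln {0, 1, 2, 3, 4} + vPln {0, 1, 5, 6, 7})
  | chi1c => (vLn {0, 1, 2, 3, 4} + vLn {2, 3, 4}) ⊔ vPt {2, 3, 4}
  | chi2a => vLn {3, 4, 5, 6, 7} + vPln {3, 4, 5, 6, 7}
  | chi2b => vLn {0, 1, 2} + vPt {0, 1, 2}
  | chi2c => vLn {0, 1, 2} + vPln {3, 4, 5, 6, 7}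
  | phi1a => vLn {0, 1, 4, 5} + vLn {0, 1, 6, 7} + vPln {0, 1, 2, 3} + vPln {4, 5, 6, 7}
  | phi1b => (vPt {0, 1} + vPt {2, 3}) ⊔ (vPln {0, 1, 2, 3, 4, 5} + vPln {0, 1, 2, 3, 6, 7})
  | phi2a => (vLn {0, 1, 2} + vLn {5, 6, 7}) ⊔ (vPln {0, 1, 2, 3, 4} + vPln {3, 4, 5, 6, 7})
  | phi2b => vPt {3, 4} + vLn {0, 1, 2, 3} + vLn {0, 1, 2, 4}
  | phi2c => vLn {0, 1, 2, 3} + vLn {0, 1, 2, 4} + vPln {0, 1, 2, 5, 6, 7}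
  | phi3a => vLn {0, 1, 2, 3} + vPln {0, 1, 2, 3} + vPln {4, 5, 6, 7}
  | phi3b => vPt {0, 1, 2, 3} + vLn {0, 1, 2, 3} + vPln {0, 1, 2, 3}
  | tcu => vTc
  | line => vLn {0, 1, 2, 3}

/-- The picture of the standard labelled building block of each kind. -/
def stdPicture : BlockKind → BlockPicture
  | alpha1a | alpha1b => .alpha1 {0, 1}
  | alpha2a | alpha2b => .alpha2 {{0, 1, 2, 3}, {4, 5, 6, 7}}
  | chi1a | chi1b | chi1c => .chi1 {0, 1} {{2, 3, 4}, {5, 6, 7}}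
  | chi2a | chi2b | chi2c => .chi2 {0, 1, 2}
  | phi1a | phi1b => .phi1 {{{0, 1}, {2, 3}}, {{4, 5}, {6, 7}}}
  | phi2a | phi2b | phi2c => .phi2 {{0, 1, 2}, {5, 6, 7}}
  | phi3a | phi3b => .phi3 {{0, 1, 2, 3}, {4, 5, 6, 7}}
  | tcu => .tcu
  | line => .line {{0, 1, 2, 3}, {4, 5, 6, 7}}

end BlockKind

/-- A building block: one of the `19` kinds, with a labelling. -/
structure Block : Type where
  kind : BlockKind
  labels : Equiv.Perm (Fin 8)

namespace Block

/-- The valuation data of a building block. -/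
def data (X : Block) : ValData := X.kind.stdData.relabel X.labels

/-- The picture of a building block. -/
def picture (X : Block) : BlockPicture := X.kind.stdPicture.relabel X.labels

end Block

/-! ### Compatibility -/

namespace BlockPicture

/-- The compatible configurations of two block pictures, modulo labelling. -/
def compatibleConfigurations : List (BlockPicture × BlockPicture) :=
  [ -- two alpha blocks
    (alpha1 {7, 0}, alpha1 {1, 2}),
    (alpha1 {7, 0}, alpha2 {{7, 0, 1, 2}, {3, 4, 5, 6}}),
    (alpha2 {{5, 6, 7, 0}, {1, 2, 3, 4}}, alpha2 {{7, 0, 1, 2}, {3, 4, 5, 6}}),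
    -- an alpha block and a chi block
    (alpha1 {0, 1}, chi1 {0, 1} {{2, 3, 4}, {5, 6, 7}}),
    (alpha1 {1, 2}, chi2 {1, 2, 3}),
    (alpha2 {{1, 2, 3, 4}, {5, 6, 7, 0}}, chi1 {0, 1} {{2, 3, 4}, {5, 6, 7}}),
    (alpha1 {2, 3}, chi1 {0, 1} {{2, 3, 4}, {5, 6, 7}}),
    (alpha2 {{7, 0, 1, 2}, {3, 4, 5, 6}}, chi1 {0, 1} {{2, 3, 4}, {5, 6, 7}}),
    (alpha1 {7, 0}, chi2 {1, 2, 3}),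
    (alpha2 {{1, 2, 3, 4}, {5, 6, 7, 0}}, chi2 {1, 2, 3}),
    -- two chi blocks
    (chi1 {7, 0} {{1, 2, 3}, {4, 5, 6}}, chi1 {1, 2} {{3, 4, 5}, {6, 7, 0}}),
    (chi1 {7, 0} {{1, 2, 3}, {4, 5, 6}}, chi2 {1, 2, 3}),
    (chi2 {2, 3, 4}, chi2 {5, 6, 7}),
    -- a phi block and an alpha block
    (phi1 {{{7, 0}, {3, 4}}, {{1, 2}, {5, 6}}}, alpha1 {7, 0}),
    (phi1 {{{7, 0}, {3, 4}}, {{1, 2}, {5, 6}}}, alpha2 {{6, 7, 0, 1}, {2, 3, 4, 5}}),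
    (phi2 {{2, 3, 4}, {5, 6, 7}}, alpha1 {2, 3}),
    (phi2 {{2, 3, 4}, {5, 6, 7}}, alpha2 {{4, 5, 6, 7}, {0, 1, 2, 3}}),
    (phi3 {{7, 0, 1, 2}, {3, 4, 5, 6}}, alpha1 {7, 0}),
    -- a phi block and a chi block
    (phi1 {{{7, 0}, {3, 4}}, {{1, 2}, {5, 6}}}, chi1 {7, 0} {{1, 2, 3}, {4, 5, 6}}),
    (phi2 {{6, 7, 0}, {1, 2, 3}}, chi1 {7, 0} {{1, 2, 3}, {4, 5, 6}}),
    (phi2 {{2, 3, 4}, {5, 6, 7}}, chi2 {5, 6, 7}),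
    (phi3 {{1, 2, 3, 4}, {5, 6, 7, 0}}, chi2 {1, 2, 3}),
    -- a hyperelliptic block and an alpha block
    (tcu, alpha1 {0, 1}),
    (line {{0, 1, 2, 3}, {4, 5, 6, 7}}, alpha1 {0, 1}),
    (line {{0, 1, 2, 3}, {4, 5, 6, 7}}, alpha2 {{1, 2, 3, 4}, {5, 6, 7, 0}}),
    -- a hyperelliptic block and a chi block
    (tcu, chi2 {0, 1, 2}),
    (line {{0, 1, 2, 3}, {4, 5, 6, 7}}, chi1 {0, 1} {{2, 3, 4}, {5, 6, 7}}),
    (line {{0, 1, 2, 3}, {4, 5, 6, 7}}, chi2 {0, 1, 2}) ]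

/-- Two block pictures are compatible if they are equal, or if they form, up to labelling, one
of the compatible configurations. -/
def Compatible (p q : BlockPicture) : Prop :=
  p = q ∨ ∃ c ∈ compatibleConfigurations, ∃ σ : Equiv.Perm (Fin 8),
    (p = c.1.relabel σ ∧ q = c.2.relabel σ) ∨ (q = c.1.relabel σ ∧ p = c.2.relabel σ)

/-- The phi block pictures, each paired with the pictures of its auxiliary blocks, modulo
labelling. -/
def auxiliaryConfigurations : List (BlockPicture × BlockPicture) :=
  [ (phi1 {{{0, 1}, {2, 3}}, {{4, 5}, {6, 7}}}, alpha2 {{0, 1, 2, 3}, {4, 5, 6, 7}}),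
    (phi1 {{{0, 1}, {2, 3}}, {{4, 5}, {6, 7}}}, line {{0, 1, 4, 5}, {2, 3, 6, 7}}),
    (phi1 {{{0, 1}, {2, 3}}, {{4, 5}, {6, 7}}}, line {{0, 1, 6, 7}, {2, 3, 4, 5}}),
    (phi2 {{0, 1, 2}, {5, 6, 7}}, alpha1 {3, 4}),
    (phi2 {{0, 1, 2}, {5, 6, 7}}, line {{0, 1, 2, 3}, {4, 5, 6, 7}}),
    (phi2 {{0, 1, 2}, {5, 6, 7}}, line {{0, 1, 2, 4}, {3, 5, 6, 7}}),
    (phi3 {{0, 1, 2, 3}, {4, 5, 6, 7}}, alpha2 {{0, 1, 2, 3}, {4, 5, 6, 7}}),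
    (phi3 {{0, 1, 2, 3}, {4, 5, 6, 7}}, tcu),
    (phi3 {{0, 1, 2, 3}, {4, 5, 6, 7}}, line {{0, 1, 2, 3}, {4, 5, 6, 7}}) ]

/-- The blocks with picture `q` are auxiliary to the phi blocks with picture `p`. -/
def IsAuxiliaryTo (q p : BlockPicture) : Prop :=
  ∃ c ∈ auxiliaryConfigurations, ∃ σ : Equiv.Perm (Fin 8),
    p = c.1.relabel σ ∧ q = c.2.relabel σ

end BlockPicture

/-! ### Block decompositions and octad pictures -/

/-- The building blocks in `B`, together with the auxiliary blocks in `b`, form a compatible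
block decomposition of the valuation data `v`. -/
structure IsCompatibleDecomposition (v : ValData) (B b : Finset Block) : Prop where
  /-- `v` is a combination of the blocks in `B` with positive rational coefficients and of the
  auxiliary blocks with non-negative rational coefficients -/
  sum_eq : ∃ m l : Block → ℚ, (∀ X ∈ B, 0 < m X) ∧ (∀ Y ∈ b, 0 ≤ l Y) ∧
    v = ∑ X ∈ B, m X • X.data + ∑ Y ∈ b, l Y • Y.data
  /-- apart from the auxiliary ones, the blocks are pairwise compatible -/
  compatible : ∀ X ∈ B, ∀ X' ∈ B, X.picture.Compatible X'.picture
  /-- each auxiliary block is auxiliary to a phi block in `B` -/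
  auxiliary : ∀ Y ∈ b, ∃ X ∈ B, Y.picture.IsAuxiliaryTo X.picture
  /-- the auxiliary blocks all have the same picture -/
  auxiliary_same : ∀ Y ∈ b, ∀ Y' ∈ b, Y.picture = Y'.picture

/-- An overlay of block pictures, recorded as the set of the pictures that are overlaid. -/
abbrev Picture : Type := Set BlockPicture

/-- The overlay of the pictures of the blocks in `B`. -/
def overlay (B : Finset Block) : Picture := {p | ∃ X ∈ B, X.picture = p}

section OctadPictures

variable {F : Type*} [Field F]

/-- `p` is the picture of some compatible block decomposition of the valuation data of `O`
(auxiliary blocks are omitted from the picture). -/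
def IsPictureOf (ν : AddValuation F (WithTop ℚ)) (O : Octad F) (p : Picture) : Prop :=
  ∃ (v : ValData) (B b : Finset Block),
    IsValuationData ν O v ∧ IsCompatibleDecomposition v B b ∧ p = overlay B

open Classical in
/-- The octad picture of `O`: it is defined (different from `none`) if the valuation data of `O`
has a compatible block decomposition, and only one up to exchanging blocks for blocks with the
same picture, and it is then the picture of that decomposition. -/
noncomputable def octadPicture (ν : AddValuation F (WithTop ℚ)) (O : Octad F) : Option Picture :=
  if h : ∃! p : Picture, IsPictureOf ν O p then some h.choose else none

end OctadPictures

end CayleyOctad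

/-! A change of coordinates followed by rescaling of the coordinate vectors multiplies the bracket
of `S` by `det G · ∏_{i ∈ S} μ i`. So the valuation data change by an affine function `c + ∑_{i ∈ S}
w i`. The twisted cubic index does not change, because both terms of each polynomial acquire the
same factor.

If five labels `F` form the standard frame, the data satisfy `IsNormalisedAt F`: they are
non-negative, they vanish on 4-subsets of `F`, and for each `i ∉ F` they vanish at some 4-set
containing `i` inside `F ∪ {i}` (a coordinate of valuation 0). An affine class contains at most one
such function (`IsNormalisedAt.eq_of_affinelyEquivalent`), so the data of `O'` are determined by
those of `O` and a frame of `O'`.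

Blocks are handled in the same way. Blocks with the same picture are affinely equivalent
(`Block.data_affinelyEquivalent`), and every picture has a block normalised at any given frame
(`Block.exists_isNormalisedAt`); both reduce to finite checks. Replacing each block of a
decomposition by such a block and keeping the coefficients yields a sum affinely equivalent to the
data of `O'`. By uniqueness it is equal to them once it is known to be normalised.

The only difficulty is a common zero of all blocks at each `i ∉ F`. Let frame labels `j`, `k` be
related if some block is nonzero at `{i} ∪ F \ {j, k}`. Geometrically, giving the fifth frame point
the coordinate 0, this is equality of the reductions of coordinates `j` and `k` of the point `i`.
Sums of two compatible blocks satisfy the tropical Plücker relations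
(`Block.data_add_isTropicalPlucker`), which makes this an equivalence relation. For one normalised
block it is not total, and two equivalence relations that cover all pairs cannot both fail to be
total. Induction handles the main blocks. The auxiliary blocks need not be compatible with them, but
share one picture and so form a second such family; a last use of the same principle combines the
two (`exists_common_zero`). -/

namespace CayleyOctad

/-! ### Affine equivalence and tropical Plücker relations -/

namespace ValData

/-- The value of `v` at a set of labels, and `0` unless the set has four elements. -/
def eval (v : ValData) (S : Finset (Fin 8)) : ℚ :=
  if h : S.card = 4 then v (some ⟨S, h⟩) else 0

theorem eval_of_card (v : ValData) {S : Finset (Fin 8)} (h : S.card = 4) :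
    v.eval S = v (some ⟨S, h⟩) := dif_pos h

theorem eval_add (u v : ValData) (S : Finset (Fin 8)) :
    (u + v).eval S = u.eval S + v.eval S := by
  unfold eval; split_ifs <;> simp

/-- The three-term tropical Plücker relations. -/
def IsTropicalPlucker (v : ValData) : Prop :=
  ∀ a b i j k l : Fin 8, [a, b, i, j, k, l].Nodup →
    min (v.eval {a, b, i, k} + v.eval {a, b, j, l}) (v.eval {a, b, i, l} + v.eval {a, b, j, k}) ≤
      v.eval {a, b, i, j} + v.eval {a, b, k, l}

/-- `u` and `v` differ by an affine function of the indicator vector of the set of labels. -/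
def AffinelyEquivalent (u v : ValData) : Prop :=
  u none = v none ∧ ∃ (c : ℚ) (w : Fin 8 → ℚ), ∀ S : Quad,
    u (some S) = v (some S) + (c + ∑ i ∈ S.1, w i)

namespace AffinelyEquivalent

theorem refl (v : ValData) : AffinelyEquivalent v v := ⟨rfl, 0, 0, fun S => by simp⟩

theorem symm {u v : ValData} (h : AffinelyEquivalent u v) : AffinelyEquivalent v u := by
  obtain ⟨h0, c, w, h⟩ := h
  refine ⟨h0.symm, -c, -w, fun S => ?_⟩
  rw [h S]; simp; ring

theorem trans {u v x : ValData} (h : AffinelyEquivalent u v) (h' : AffinelyEquivalent v x) :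
    AffinelyEquivalent u x := by
  obtain ⟨h0, c, w, h⟩ := h
  obtain ⟨h0', c', w', h'⟩ := h'
  refine ⟨h0.trans h0', c + c', w + w', fun S => ?_⟩
  rw [h S, h' S]; simp [Finset.sum_add_distrib]; ring

theorem add {u v u' v' : ValData} (h : AffinelyEquivalent u v) (h' : AffinelyEquivalent u' v') :
    AffinelyEquivalent (u + u') (v + v') := by
  obtain ⟨h0, c, w, h⟩ := h
  obtain ⟨h0', c', w', h'⟩ := h'
  refine ⟨by simp [h0, h0'], c + c', w + w', fun S => ?_⟩
  simp only [Pi.add_apply]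
  rw [h S, h' S]; simp [Finset.sum_add_distrib]; ring

theorem smul {u v : ValData} (h : AffinelyEquivalent u v) (m : ℚ) :
    AffinelyEquivalent (m • u) (m • v) := by
  obtain ⟨h0, c, w, h⟩ := h
  refine ⟨by simp [h0], m * c, fun i => m * w i, fun S => ?_⟩
  simp only [Pi.smul_apply, smul_eq_mul]
  rw [h S, ← Finset.mul_sum]; ring

theorem sum {ι : Type*} (s : Finset ι) {u v : ι → ValData}
    (h : ∀ X ∈ s, AffinelyEquivalent (u X) (v X)) :
    AffinelyEquivalent (∑ X ∈ s, u X) (∑ X ∈ s, v X) := by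
  classical
  induction s using Finset.induction_on with
  | empty => simpa using refl 0
  | insert a s ha ih =>
    rw [Finset.sum_insert ha, Finset.sum_insert ha]
    exact (h a (by simp)).add (ih fun X hX => h X (by simp [hX]))

theorem relabel {u v : ValData} (h : AffinelyEquivalent u v) (σ : Equiv.Perm (Fin 8)) :
    AffinelyEquivalent (u.relabel σ) (v.relabel σ) := by
  obtain ⟨h0, c, w, h⟩ := h
  refine ⟨h0, c, fun i => w (σ.symm i), fun S => ?_⟩
  simp only [ValData.relabel, h, Finset.sum_map, Equiv.coe_toEmbedding]

end AffinelyEquivalent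

theorem eval_relabel (v : ValData) (σ : Equiv.Perm (Fin 8)) (S : Finset (Fin 8)) :
    (v.relabel σ).eval S = v.eval (S.map σ.symm.toEmbedding) := by
  simp only [eval, Finset.card_map]
  rfl

theorem relabel_add (u v : ValData) (σ : Equiv.Perm (Fin 8)) :
    (u + v).relabel σ = u.relabel σ + v.relabel σ := by
  funext S; cases S <;> rfl

theorem relabel_mul (v : ValData) (σ τ : Equiv.Perm (Fin 8)) :
    v.relabel (σ * τ) = (v.relabel τ).relabel σ := by
  funext S
  cases S with
  | none => rfl
  | some S =>
    simp only [relabel, Finset.map_map]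
    rfl

namespace IsTropicalPlucker

theorem relabel {v : ValData} (h : v.IsTropicalPlucker) (σ : Equiv.Perm (Fin 8)) :
    (v.relabel σ).IsTropicalPlucker := by
  intro a b i j k l hn
  have := h (σ.symm a) (σ.symm b) (σ.symm i) (σ.symm j) (σ.symm k) (σ.symm l)
    (by simpa using hn.map σ.symm.injective)
  simpa [eval_relabel, Finset.map_insert] using this

/-- In each of the three sums of a relation, `a` and `b` occur twice and `i`, `j`, `k`, `l` once, so
an affine function shifts all three sums equally. -/
theorem of_affinelyEquivalent {u v : ValData} (h : u.IsTropicalPlucker)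
    (huv : AffinelyEquivalent u v) : v.IsTropicalPlucker := by
  obtain ⟨-, c, w, huv⟩ := huv.symm
  have key : ∀ a b i j : Fin 8, [a, b, i, j].Nodup →
      v.eval {a, b, i, j} = u.eval {a, b, i, j} + (c + (w a + w b + w i + w j)) := by
    intro a b i j hn
    simp only [List.nodup_cons, List.mem_cons, List.not_mem_nil, or_false, not_or,
      List.nodup_nil, not_false_eq_true, and_true] at hn
    obtain ⟨⟨hab, hai, haj⟩, ⟨hbi, hbj⟩, hij⟩ := hn
    have hc : ({a, b, i, j} : Finset (Fin 8)).card = 4 := by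
      rw [Finset.card_eq_of_equiv_fin]
      exact (Finset.equivFinOfCardEq (by
        rw [Finset.card_insert_of_notMem (by simp [*]), Finset.card_insert_of_notMem (by simp [*]),
          Finset.card_insert_of_notMem (by simp [*]), Finset.card_singleton]))
    rw [eval_of_card _ hc, eval_of_card _ hc, huv]
    rw [Finset.sum_insert (by simp [*]), Finset.sum_insert (by simp [*]),
      Finset.sum_insert (by simp [*]), Finset.sum_singleton]
    ring
  intro a b i j k l hn
  have := h a b i j k l hn
  simp only [List.nodup_cons, List.mem_cons, List.not_mem_nil, or_false, not_or,
      List.nodup_nil, not_false_eq_true, and_true] at hn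
  obtain ⟨⟨hab, hai, haj, hak, hal⟩, ⟨hbi, hbj, hbk, hbl⟩, ⟨hij, hik, hil⟩, ⟨hjk, hjl⟩, hkl⟩ := hn
  rw [key a b i j (by simp [*]), key a b k l (by simp [*]), key a b i k (by simp [*]),
    key a b j l (by simp [*]), key a b i l (by simp [*]), key a b j k (by simp [*])]
  rw [min_le_iff] at this ⊢
  rcases this with h | h
  · left; linarith
  · right; linarith

/-- The relations are not stable under addition in general. Doubling is harmless, and this settles
pairs of blocks with equal pictures. -/
theorem add_self {v : ValData} (h : v.IsTropicalPlucker) : (v + v).IsTropicalPlucker := by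
  intro a b i j k l hn
  have := h a b i j k l hn
  simp only [eval_add]
  rw [min_le_iff] at this ⊢
  rcases this with h | h
  · left; linarith
  · right; linarith

end IsTropicalPlucker

/-! ### Normalisation at a projective frame -/

/-- `v` could be the valuation data of an octad in which the points with labels in `F` form the
standard frame. -/
structure IsNormalisedAt (F : Finset (Fin 8)) (v : ValData) : Prop where
  nonneg : ∀ S : Quad, 0 ≤ v (some S)
  frame : ∀ S : Quad, S.1 ⊆ F → v (some S) = 0
  point : ∀ i ∉ F, ∃ S : Quad, i ∈ S.1 ∧ S.1 ⊆ insert i F ∧ v (some S) = 0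

theorem IsNormalisedAt.relabel {F : Finset (Fin 8)} {v : ValData} (h : v.IsNormalisedAt F)
    (σ : Equiv.Perm (Fin 8)) : (v.relabel σ).IsNormalisedAt (F.map σ.toEmbedding) where
  nonneg S := h.nonneg _
  frame S hS := h.frame _ (by
    intro x hx
    simp only [Finset.mem_map_equiv, Equiv.symm_symm] at hx
    have := hS hx
    simpa using this)
  point i hi := by
    obtain ⟨S, h1, h2, h3⟩ := h.point (σ.symm i) (by simpa using hi)
    refine ⟨⟨S.1.map σ.toEmbedding, by rw [Finset.card_map]; exact S.2⟩, ?_, ?_, ?_⟩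
    · simpa using h1
    · intro x hx
      simp only [Finset.mem_map_equiv] at hx
      have := h2 hx
      simpa using this
    · simp only [ValData.relabel]
      rw [← h3]
      congr 3
      ext x; simp

theorem sum_quad_of_const {F : Finset (Fin 8)} {w : Fin 8 → ℚ} {ω : ℚ} {i : Fin 8}
    (hw : ∀ j ∈ F, w j = ω) (S : Quad) (hi : i ∈ S.1) (hS : S.1 ⊆ insert i F) :
    ∑ j ∈ S.1, w j = w i + 3 * ω := by
  rw [← Finset.add_sum_erase _ _ hi, Finset.sum_congr rfl (g := fun _ => ω), Finset.sum_const,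
    Finset.card_erase_of_mem hi, S.2]
  · simp
  · intro j hj
    rw [Finset.mem_erase] at hj
    have := hS hj.2
    rw [Finset.mem_insert] at this
    exact hw j (this.resolve_left hj.1)

/-- Each affine equivalence class has at most one normalised element. -/
theorem IsNormalisedAt.eq_of_affinelyEquivalent {F : Finset (Fin 8)} (hF : F.card = 5)
    {u v : ValData} (hu : u.IsNormalisedAt F) (hv : v.IsNormalisedAt F)
    (h : AffinelyEquivalent u v) : u = v := by
  obtain ⟨h0, c, w, h⟩ := h
  -- Both functions vanish on `F` minus one point, so `w` takes the same value at every frame label.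
  -- With `F.card = 5` that value `ω` satisfies `ω = c + 5ω`.
  have hF1 : ∀ j ∈ F, w j = c + ∑ i ∈ F, w i := by
    intro j hj
    have hc : (F.erase j).card = 4 := by rw [Finset.card_erase_of_mem hj, hF]
    have := h ⟨F.erase j, hc⟩
    rw [hu.frame _ (Finset.erase_subset _ _), hv.frame _ (Finset.erase_subset _ _)] at this
    rw [← Finset.add_sum_erase _ _ hj]
    simp only at this
    linarith
  obtain ⟨ω, hω⟩ : ∃ ω, ω = c + ∑ i ∈ F, w i := ⟨_, rfl⟩
  rw [← hω] at hF1
  have hc : c = -4 * ω := by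
    rw [Finset.sum_congr rfl hF1, Finset.sum_const, hF] at hω
    simp at hω
    linarith
  -- A zero of `u` at `i` gives `w i ≤ ω` because `v` is non-negative there; a zero of `v` gives the
  -- reverse inequality.
  have hall : ∀ i, w i = ω := by
    intro i
    by_cases hi : i ∈ F
    · exact hF1 i hi
    obtain ⟨S, h1, h2, h3⟩ := hu.point i hi
    obtain ⟨S', h1', h2', h3'⟩ := hv.point i hi
    have e := h S
    have e' := h S'
    rw [sum_quad_of_const hF1 S h1 h2, h3] at e
    rw [sum_quad_of_const hF1 S' h1' h2', h3'] at e'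
    have n := hv.nonneg S
    have n' := hu.nonneg S'
    linarith
  funext S
  cases S with
  | none => exact h0
  | some S =>
    rw [h S, Finset.sum_congr rfl (fun i _ => hall i), Finset.sum_const, S.2]
    simp
    linarith

/-! ### Common zeros of normalised families -/

/-- If two equivalence relations cover all pairs, then one of them does. -/
theorem forall_rel_or_forall_rel {α : Type*} (r s : Setoid α) (h : ∀ x y, r x y ∨ s x y) :
    (∀ x y, r x y) ∨ ∀ x y, s x y := by
  by_contra! hc
  obtain ⟨⟨a, b, hab⟩, c, d, hcd⟩ := hc
  -- If `x` is not `s`-related to `a`, then `r a x`, so `b` and `x` cannot be `r`-related; hence `s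
  -- b x`, and `s a b` gives a contradiction.
  have key : ∀ x, s a x := by
    intro x
    by_contra hx
    have h1 : r a x := (h a x).resolve_right hx
    have h2 : s b x := (h b x).resolve_left fun h2 => hab (r.trans' h1 (r.symm' h2))
    exact hx (s.trans' ((h a b).resolve_left hab) h2)
  exact hcd (s.trans' (s.symm' (key c)) (key d))

theorem card_insert_sdiff_pair {F : Finset (Fin 8)} (hF : F.card = 5) {i : Fin 8} (hi : i ∉ F)
    {j k : Fin 8} (hj : j ∈ F) (hk : k ∈ F) (hjk : j ≠ k) :
    (insert i (F \ {j, k})).card = 4 := by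
  rw [Finset.card_insert_of_notMem (by simp [hi]), Finset.card_sdiff_of_subset, hF,
    Finset.card_pair hjk]
  intro x hx
  simp at hx
  rcases hx with rfl | rfl <;> assumption

theorem IsNormalisedAt.eval_frame {F : Finset (Fin 8)} {v : ValData} (hv : v.IsNormalisedAt F)
    {S : Finset (Fin 8)} (hS : S ⊆ F) : v.eval S = 0 := by
  unfold eval
  split_ifs with h
  · exact hv.frame _ hS
  · rfl

theorem IsNormalisedAt.eval_nonneg {F : Finset (Fin 8)} {v : ValData} (hv : v.IsNormalisedAt F)
    (S : Finset (Fin 8)) : 0 ≤ v.eval S := by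
  unfold eval
  split_ifs with h
  · exact hv.nonneg _
  · rfl

/-- Transitivity of the coplanarity relation. In the Plücker relation for `u + v` on the two
remaining frame points `a`, `b` and `i, j, k, l`, the brackets of frame points vanish. The value at
`{a, b, i, k}` is thus at least the smaller of those at `{a, b, i, j}` and `{a, b, i, l}`, and both
of these are positive. -/
theorem eval_pos_trans {F : Finset (Fin 8)} (hF : F.card = 5) {u v : ValData}
    (hu : u.IsNormalisedAt F) (hv : v.IsNormalisedAt F) (huv : (u + v).IsTropicalPlucker)
    {i : Fin 8} (hi : i ∉ F) {j k l : Fin 8} (hj : j ∈ F) (hk : k ∈ F) (hl : l ∈ F)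
    (hjk : j ≠ k) (hkl : k ≠ l) (hjl : j ≠ l)
    (h : u.eval (insert i (F \ {j, k})) ≠ 0) (h' : v.eval (insert i (F \ {k, l})) ≠ 0) :
    u.eval (insert i (F \ {j, l})) ≠ 0 ∨ v.eval (insert i (F \ {j, l})) ≠ 0 := by
  obtain ⟨a, b, hab, hFab⟩ : ∃ a b, a ≠ b ∧ F \ {j, k, l} = {a, b} := by
    apply Finset.card_eq_two.1
    rw [Finset.card_sdiff_of_subset, hF]
    · rw [Finset.card_eq_three.2 ⟨j, k, l, hjk, hjl, hkl, rfl⟩]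
    · intro x hx
      simp at hx
      rcases hx with rfl | rfl | rfl <;> assumption
  have ha : a ∈ F \ {j, k, l} := by simp [hFab]
  have hb : b ∈ F \ {j, k, l} := by simp [hFab]
  have hmem : ∀ x, x ∈ F ↔ (x = a ∨ x = b) ∨ x = j ∨ x = k ∨ x = l := by
    intro x
    have : x ∈ F \ {j, k, l} ↔ x = a ∨ x = b := by simp [hFab]
    simp only [Finset.mem_sdiff, Finset.mem_insert, Finset.mem_singleton] at this
    constructor
    · intro hx; tauto
    · rintro (h | rfl | rfl | rfl)
      · exact (this.2 h).1
      all_goals assumption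
  simp only [Finset.mem_sdiff, Finset.mem_insert, Finset.mem_singleton, not_or] at ha hb
  obtain ⟨haF, haj, hak, hal⟩ := ha
  obtain ⟨hbF, hbj, hbk, hbl⟩ := hb
  have hia : i ≠ a := fun h => hi (h ▸ haF)
  have hib : i ≠ b := fun h => hi (h ▸ hbF)
  have hij : i ≠ j := fun h => hi (h ▸ hj)
  have hik : i ≠ k := fun h => hi (h ▸ hk)
  have hil : i ≠ l := fun h => hi (h ▸ hl)
  have e1 : insert i (F \ {j, k}) = {a, b, i, l} := by
    ext x; simp only [Finset.mem_insert, Finset.mem_sdiff, hmem, Finset.mem_singleton]; grind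
  have e2 : insert i (F \ {k, l}) = {a, b, i, j} := by
    ext x; simp only [Finset.mem_insert, Finset.mem_sdiff, hmem, Finset.mem_singleton]; grind
  have e3 : insert i (F \ {j, l}) = {a, b, i, k} := by
    ext x; simp only [Finset.mem_insert, Finset.mem_sdiff, hmem, Finset.mem_singleton]; grind
  have hP := huv a b i k j l (by
    simp only [List.nodup_cons, List.mem_cons, List.not_mem_nil, or_false, not_or,
      List.nodup_nil, not_false_eq_true, and_true]
    grind)
  have z : ∀ x y, x ∈ F → y ∈ F → (u + v).eval {a, b, x, y} = 0 := by
    intro x y hx hy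
    have hs : ({a, b, x, y} : Finset (Fin 8)) ⊆ F := by
      intro t ht
      simp only [Finset.mem_insert, Finset.mem_singleton] at ht
      rcases ht with rfl | rfl | rfl | rfl <;> assumption
    rw [eval_add, hu.eval_frame hs, hv.eval_frame hs, add_zero]
  rw [z k l hk hl, z k j hk hj, z j l hj hl, eval_add, eval_add, eval_add] at hP
  rw [e1] at h
  rw [e2] at h'
  rw [e3]
  by_contra! hc
  rw [hc.1, hc.2] at hP
  have p1 := lt_of_le_of_ne (hu.eval_nonneg _) h.symm
  have p2 := lt_of_le_of_ne (hv.eval_nonneg _) h'.symm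
  have p3 := hu.eval_nonneg {a, b, i, j}
  have p4 := hv.eval_nonneg {a, b, i, l}
  rw [min_le_iff] at hP
  rcases hP with h | h <;> linarith

/-- The frame points `j` and `k` are related if, in some member of the family `u`, the point `i`
and the frame points other than `j`, `k` are coplanar after reduction. -/
def coplanarSetoid {F : Finset (Fin 8)} (hF : F.card = 5) {ι : Type*} (s : Finset ι)
    (u : ι → ValData) (hu : ∀ X ∈ s, (u X).IsNormalisedAt F)
    (huv : ∀ X ∈ s, ∀ Y ∈ s, (u X + u Y).IsTropicalPlucker) {i : Fin 8} (hi : i ∉ F) :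
    Setoid F where
  -- For `j = k` the set has five elements and `eval` takes its default value `0` there, so
  -- reflexivity has to be imposed.
  r j k := j = k ∨ ∃ X ∈ s, (u X).eval (insert i (F \ {j.1, k.1})) ≠ 0
  iseqv := by
    refine ⟨fun j => Or.inl rfl, ?_, ?_⟩
    · rintro j k (rfl | ⟨X, hX, h⟩)
      · exact Or.inl rfl
      · exact Or.inr ⟨X, hX, by rwa [Finset.pair_comm]⟩
    · rintro j k l (rfl | ⟨X, hX, h⟩)
      · exact id
      rintro (rfl | ⟨Y, hY, h'⟩)
      · exact Or.inr ⟨X, hX, h⟩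
      by_cases hjl : j = l
      · exact Or.inl hjl
      by_cases hjk : j = k
      · subst hjk; exact Or.inr ⟨Y, hY, h'⟩
      by_cases hkl : k = l
      · subst hkl; exact Or.inr ⟨X, hX, h⟩
      rcases eval_pos_trans hF (hu X hX) (hu Y hY) (huv X hX Y hY) hi j.2 k.2 l.2
        (by rwa [Ne, Subtype.coe_inj]) (by rwa [Ne, Subtype.coe_inj])
        (by rwa [Ne, Subtype.coe_inj]) h h' with h | h
      · exact Or.inr ⟨X, hX, h⟩
      · exact Or.inr ⟨Y, hY, h⟩

/-- Induction on the family: if the relation of `insert X s` were total, the relations of `{X}` and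
of `s` would cover all pairs, so one of them would be total. The zero of `X` at `i` excludes the
first, the induction hypothesis the second. -/
theorem exists_not_coplanar {F : Finset (Fin 8)} (hF : F.card = 5) {ι : Type*} (s : Finset ι)
    (u : ι → ValData) (hu : ∀ X ∈ s, (u X).IsNormalisedAt F)
    (huv : ∀ X ∈ s, ∀ Y ∈ s, (u X + u Y).IsTropicalPlucker) {i : Fin 8} (hi : i ∉ F) :
    ∃ j k, ¬ coplanarSetoid hF s u hu huv hi j k := by
  classical
  induction s using Finset.induction_on with
  | empty =>
    obtain ⟨j, hj, k, hk, hjk⟩ := Finset.one_lt_card.1 (by omega : 1 < F.card)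
    refine ⟨⟨j, hj⟩, ⟨k, hk⟩, ?_⟩
    rintro (h | ⟨X, hX, -⟩)
    · exact hjk (by simpa using h)
    · simp at hX
  | insert X s hX ih =>
    by_contra! hc
    have hcover := forall_rel_or_forall_rel
      (coplanarSetoid hF {X} u (fun Y hY => hu Y (by simp_all))
        (fun Y hY Z hZ => huv Y (by simp_all) Z (by simp_all)) hi)
      (coplanarSetoid hF s u (fun Y hY => hu Y (by simp_all))
        (fun Y hY Z hZ => huv Y (by simp_all) Z (by simp_all)) hi)
    rcases hcover fun j k => by
      rcases hc j k with h | ⟨Y, hY, h⟩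
      · exact Or.inl (Or.inl h)
      · rcases Finset.mem_insert.1 hY with rfl | hY
        · exact Or.inl (Or.inr ⟨Y, by simp, h⟩)
        · exact Or.inr (Or.inr ⟨Y, hY, h⟩) with h | h
    · obtain ⟨S, h1, h2, h3⟩ := (hu X (by simp)).point i hi
      have hc2 : (F \ S.1).card = 2 := by
        have e : F \ S.1 = (insert i F) \ S.1 := by
          rw [Finset.insert_sdiff_of_mem _ h1]
        rw [e, Finset.card_sdiff_of_subset h2, Finset.card_insert_of_notMem hi, S.2, hF]
      -- The zero `S` of `X` consists of `i` and three frame points; the two frame points that it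
      -- omits are unrelated.
      obtain ⟨j, k, hjk, e⟩ := Finset.card_eq_two.1 hc2
      have hj : j ∈ F \ S.1 := by simp [e]
      have hk : k ∈ F \ S.1 := by simp [e]
      rw [Finset.mem_sdiff] at hj hk
      rcases h ⟨j, hj.1⟩ ⟨k, hk.1⟩ with h | ⟨Y, hY, h4⟩
      · exact hjk (by simpa using h)
      · rw [Finset.mem_singleton] at hY
        subst hY
        apply h4
        have : insert i (F \ {j, k}) = S.1 := by
          rw [← e]
          ext x
          simp only [Finset.mem_insert, Finset.mem_sdiff, not_and, not_not]
          constructor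
          · rintro (rfl | ⟨h, h'⟩)
            · exact h1
            · exact h' h
          · intro hx
            have := h2 hx
            rw [Finset.mem_insert] at this
            by_cases hxi : x = i
            · exact Or.inl hxi
            · exact Or.inr ⟨this.resolve_left hxi, fun _ => hx⟩
        simp only [this]
        rw [eval_of_card _ S.2]
        exact h3
    · obtain ⟨j, k, hjk⟩ := ih (fun Y hY => hu Y (by simp_all))
        (fun Y hY Z hZ => huv Y (by simp_all) Z (by simp_all))
      exact hjk (h j k)

/-- Two families of normalised valuation data, each pairwise satisfying the tropical Plücker
relations, have a common zero at every point outside the frame. -/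
theorem exists_common_zero {F : Finset (Fin 8)} (hF : F.card = 5) {ι : Type*} (s t : Finset ι)
    (u : ι → ValData) (hs : ∀ X ∈ s, (u X).IsNormalisedAt F)
    (hss : ∀ X ∈ s, ∀ Y ∈ s, (u X + u Y).IsTropicalPlucker)
    (ht : ∀ X ∈ t, (u X).IsNormalisedAt F)
    (htt : ∀ X ∈ t, ∀ Y ∈ t, (u X + u Y).IsTropicalPlucker) {i : Fin 8} (hi : i ∉ F) :
    ∃ S : Quad, i ∈ S.1 ∧ S.1 ⊆ insert i F ∧ (∀ X ∈ s, u X (some S) = 0) ∧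
      ∀ X ∈ t, u X (some S) = 0 := by
  obtain ⟨j, k, h1, h2⟩ : ∃ j k, ¬ coplanarSetoid hF s u hs hss hi j k ∧
      ¬ coplanarSetoid hF t u ht htt hi j k := by
    by_contra! hc
    -- A pair unrelated in both families is the same as a common zero; without one, the two
    -- relations would cover all pairs.
    rcases forall_rel_or_forall_rel _ _ (fun j k => or_iff_not_imp_left.2 (hc j k)) with h | h
    · obtain ⟨j, k, hjk⟩ := exists_not_coplanar hF s u hs hss hi
      exact hjk (h j k)
    · obtain ⟨j, k, hjk⟩ := exists_not_coplanar hF t u ht htt hi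
      exact hjk (h j k)
  have hjk : j ≠ k := fun h => h1 (Or.inl h)
  have hc := card_insert_sdiff_pair hF hi j.2 k.2 (by rwa [Ne, Subtype.coe_inj])
  refine ⟨⟨_, hc⟩, by simp, ?_, ?_, ?_⟩
  · exact Finset.insert_subset_insert _ Finset.sdiff_subset
  · intro X hX
    by_contra h
    exact h1 (Or.inr ⟨X, hX, by rwa [eval_of_card _ hc]⟩)
  · intro X hX
    by_contra h
    exact h2 (Or.inr ⟨X, hX, by rwa [eval_of_card _ hc]⟩)

end ValData

/-! ### Block data in terms of indicator functions -/

/-- The indicator function of a set of labels. -/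
def indicator (S : Finset (Fin 8)) (i : Fin 8) : ℕ := if i ∈ S then 1 else 0

theorem card_inter_eq_sum (S T : Finset (Fin 8)) :
    (S ∩ T).card = ∑ t ∈ T, indicator S t := by
  simp [indicator, Finset.inter_comm S T, ← Finset.filter_mem_eq_inter]

theorem vPt_some (T : Finset (Fin 8)) (S : Quad) :
    vPt T (some S) = ((∑ t ∈ T, indicator S.1 t - 1 : ℕ) : ℚ) := by
  rw [← card_inter_eq_sum]; rfl

theorem vLn_some (T : Finset (Fin 8)) (S : Quad) :
    vLn T (some S) = ((∑ t ∈ T, indicator S.1 t - 2 : ℕ) : ℚ) := by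
  rw [← card_inter_eq_sum]; rfl

theorem vPln_some (T : Finset (Fin 8)) (S : Quad) :
    vPln T (some S) = ((∑ t ∈ T, indicator S.1 t - 3 : ℕ) : ℚ) := by
  rw [← card_inter_eq_sum]; rfl

namespace BlockKind
/-- The value of `stdData` at a set of four labels, in terms of its indicator function. -/
def value : BlockKind → (Fin 8 → ℕ) → ℕ
  | alpha1a, b => b 0 + b 1 - 1
  | alpha1b, b => b 2 + b 3 + b 4 + b 5 + b 6 + b 7 - 3
  | alpha2a, b => (b 0 + b 1 + b 2 + b 3 - 3) + (b 4 + b 5 + b 6 + b 7 - 3)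
  | alpha2b, b => (b 0 + b 1 + b 2 + b 3 - 3) + (b 0 + b 1 + b 2 + b 3 - 1)
  | chi1a, b => max ((b 2 + b 3 + b 4 - 2) + (b 5 + b 6 + b 7 - 2))
      (b 2 + b 3 + b 4 + b 5 + b 6 + b 7 - 3)
  | chi1b, b => max (b 0 + b 1 - 1)
      ((b 0 + b 1 + b 2 + b 3 + b 4 - 3) + (b 0 + b 1 + b 5 + b 6 + b 7 - 3))
  | chi1c, b => max ((b 0 + b 1 + b 2 + b 3 + b 4 - 2) + (b 2 + b 3 + b 4 - 2))
      (b 2 + b 3 + b 4 - 1)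
  | chi2a, b => (b 3 + b 4 + b 5 + b 6 + b 7 - 2) + (b 3 + b 4 + b 5 + b 6 + b 7 - 3)
  | chi2b, b => (b 0 + b 1 + b 2 - 2) + (b 0 + b 1 + b 2 - 1)
  | chi2c, b => (b 0 + b 1 + b 2 - 2) + (b 3 + b 4 + b 5 + b 6 + b 7 - 3)
  | phi1a, b => (b 0 + b 1 + b 4 + b 5 - 2) + (b 0 + b 1 + b 6 + b 7 - 2) +
      (b 0 + b 1 + b 2 + b 3 - 3) + (b 4 + b 5 + b 6 + b 7 - 3)
  | phi1b, b => max ((b 0 + b 1 - 1) + (b 2 + b 3 - 1))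
      ((b 0 + b 1 + b 2 + b 3 + b 4 + b 5 - 3) + (b 0 + b 1 + b 2 + b 3 + b 6 + b 7 - 3))
  | phi2a, b => max ((b 0 + b 1 + b 2 - 2) + (b 5 + b 6 + b 7 - 2))
      ((b 0 + b 1 + b 2 + b 3 + b 4 - 3) + (b 3 + b 4 + b 5 + b 6 + b 7 - 3))
  | phi2b, b => (b 3 + b 4 - 1) + (b 0 + b 1 + b 2 + b 3 - 2) + (b 0 + b 1 + b 2 + b 4 - 2)
  | phi2c, b => (b 0 + b 1 + b 2 + b 3 - 2) + (b 0 + b 1 + b 2 + b 4 - 2) +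
      (b 0 + b 1 + b 2 + b 5 + b 6 + b 7 - 3)
  | phi3a, b => (b 0 + b 1 + b 2 + b 3 - 2) + (b 0 + b 1 + b 2 + b 3 - 3) +
      (b 4 + b 5 + b 6 + b 7 - 3)
  | phi3b, b => (b 0 + b 1 + b 2 + b 3 - 1) + (b 0 + b 1 + b 2 + b 3 - 2) +
      (b 0 + b 1 + b 2 + b 3 - 3)
  | tcu, _ => 0
  | line, b => b 0 + b 1 + b 2 + b 3 - 2

theorem stdData_some (k : BlockKind) (S : Quad) :
    k.stdData (some S) = (k.value (indicator S.1) : ℚ) := by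
  cases k <;>
    simp [stdData, value, vPt_some, vLn_some, vPln_some, Finset.sum_insert, ← add_assoc, vTc]

end BlockKind

theorem indicator_map_symm (S : Finset (Fin 8)) (σ : Equiv.Perm (Fin 8)) (i : Fin 8) :
    indicator (S.map σ.symm.toEmbedding) i = indicator S (σ i) := by
  simp [indicator]

namespace Block

theorem data_some (X : Block) (S : Quad) :
    X.data (some S) = (X.kind.value fun i => indicator S.1 (X.labels i) : ℕ) := by
  simp only [data, ValData.relabel, BlockKind.stdData_some]
  rw [funext (indicator_map_symm S.1 X.labels)]

theorem data_nonneg (X : Block) (S : Quad) : 0 ≤ X.data (some S) := by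
  rw [data_some]; positivity

end Block

/-! ### Blocks with the same picture -/

namespace ValData

theorem relabel_sum {ι : Type*} (s : Finset ι) (u : ι → ValData) (σ : Equiv.Perm (Fin 8)) :
    (∑ X ∈ s, u X).relabel σ = ∑ X ∈ s, (u X).relabel σ := by
  funext S
  cases S <;> simp [relabel, Finset.sum_apply]

theorem relabel_sup (u v : ValData) (σ : Equiv.Perm (Fin 8)) :
    (u ⊔ v).relabel σ = u.relabel σ ⊔ v.relabel σ := by
  funext S; cases S <;> rfl

theorem relabel_smul (m : ℚ) (v : ValData) (σ : Equiv.Perm (Fin 8)) :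
    (m • v).relabel σ = m • v.relabel σ := by
  funext S; cases S <;> rfl

theorem relabel_vPt (T : Finset (Fin 8)) (σ : Equiv.Perm (Fin 8)) :
    (vPt T).relabel σ = vPt (T.image σ) := by
  funext S
  cases S with
  | none => rfl
  | some S =>
    simp only [relabel, vPt_some, indicator_map_symm]
    rw [Finset.sum_image σ.injective.injOn]

theorem relabel_vLn (T : Finset (Fin 8)) (σ : Equiv.Perm (Fin 8)) :
    (vLn T).relabel σ = vLn (T.image σ) := by
  funext S
  cases S with
  | none => rfl
  | some S =>
    simp only [relabel, vLn_some, indicator_map_symm]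
    rw [Finset.sum_image σ.injective.injOn]

theorem relabel_vPln (T : Finset (Fin 8)) (σ : Equiv.Perm (Fin 8)) :
    (vPln T).relabel σ = vPln (T.image σ) := by
  funext S
  cases S with
  | none => rfl
  | some S =>
    simp only [relabel, vPln_some, indicator_map_symm]
    rw [Finset.sum_image σ.injective.injOn]

end ValData

namespace BlockPicture

/-- Valuation data attached to a block picture, equivariant under relabelling and affinely
equivalent to the data of the blocks with this picture. -/
noncomputable def canonicalData : BlockPicture → ValData
  | alpha1 T => vPt T
  | alpha2 π => ∑ T ∈ π, vPln T
  | chi1 T π => vPt T ⊔ ∑ U ∈ π, vPln (T ∪ U)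
  | chi2 T => vLn T + vPt T
  -- The halves of this picture are unordered but the block expressions single one out, hence the
  -- average over both; likewise for `phi3` and `line`.
  | phi1 π => (1 / 2 : ℚ) • ∑ A ∈ π, ((∑ T ∈ A, vPt T) ⊔ ∑ A' ∈ π.erase A, ∑ T ∈ A', vPln Tᶜ)
  | phi2 π => (∑ T ∈ π, vLn T) ⊔ ∑ T ∈ π, vPln Tᶜ
  | phi3 π => (1 / 2 : ℚ) • ∑ T ∈ π, (vLn T + (2 : ℚ) • vPln T)
  | tcu => vTc
  | line π => (1 / 2 : ℚ) • ∑ T ∈ π, vLn T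

/-- Since relabelling commutes with the construction, blocks need to be compared with canonical data
only for the standard labelling. -/
theorem canonicalData_relabel (σ : Equiv.Perm (Fin 8)) (p : BlockPicture) :
    (p.relabel σ).canonicalData = p.canonicalData.relabel σ := by
  have h1 : Function.Injective (Finset.image σ) := Finset.image_injective σ.injective
  have h2 : Function.Injective (Finset.image (Finset.image σ)) := Finset.image_injective h1
  have hc : ∀ T : Finset (Fin 8), (T.image σ)ᶜ = Tᶜ.image σ := by
    intro T; ext x; simp [Finset.mem_image, ← Equiv.eq_symm_apply]
  cases p <;>
    simp only [relabel, canonicalData, ValData.relabel_sum, ValData.relabel_sup,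
      ValData.relabel_smul, ValData.relabel_vPt, ValData.relabel_vLn, ValData.relabel_vPln,
      ValData.relabel_add, Finset.sum_image h1.injOn, Finset.sum_image h2.injOn,
      Finset.image_union, hc, ← Finset.image_erase h2]
  -- The remaining case is `tcu`.
  funext S; cases S <;> rfl

end BlockPicture

/-! ### Canonical data of the standard pictures, doubled to clear denominators -/

namespace BlockKind

/-- Twice the value of the canonical data of `stdPicture`, in terms of indicator functions. -/
def canonicalValue : BlockKind → (Fin 8 → ℕ) → ℕ
  | alpha1a, b | alpha1b, b => 2 * alpha1a.value b
  | alpha2a, b | alpha2b, b => 2 * alpha2a.value b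
  | chi1a, b | chi1b, b | chi1c, b => 2 * chi1b.value b
  | chi2a, b | chi2b, b | chi2c, b => 2 * chi2b.value b
  | phi1a, b | phi1b, b => phi1b.value b + max ((b 4 + b 5 - 1) + (b 6 + b 7 - 1))
      ((b 2 + b 3 + b 4 + b 5 + b 6 + b 7 - 3) + (b 0 + b 1 + b 4 + b 5 + b 6 + b 7 - 3))
  | phi2a, b | phi2b, b | phi2c, b => 2 * phi2a.value b
  | phi3a, b | phi3b, b => line.value b + 2 * (b 0 + b 1 + b 2 + b 3 - 3) +
      ((b 4 + b 5 + b 6 + b 7 - 2) + 2 * (b 4 + b 5 + b 6 + b 7 - 3))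
  | tcu, _ => 0
  | line, b => line.value b + (b 4 + b 5 + b 6 + b 7 - 2)

theorem sum_halves {M : Type*} [AddCommMonoid M] (u : Finset (Fin 8) → M) :
    ∑ T ∈ ({{0, 1, 2, 3}, {4, 5, 6, 7}} : Finset (Finset (Fin 8))), u T =
      u {0, 1, 2, 3} + u {4, 5, 6, 7} := Finset.sum_pair (by decide)

theorem canonicalData_phi1 : phi1a.stdPicture.canonicalData =
    (1 / 2 : ℚ) • (((vPt {0, 1} + vPt {2, 3}) ⊔
      (vPln {0, 1, 2, 3, 4, 5} + vPln {0, 1, 2, 3, 6, 7})) +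
      ((vPt {4, 5} + vPt {6, 7}) ⊔
        (vPln {2, 3, 4, 5, 6, 7} + vPln {0, 1, 4, 5, 6, 7}))) := by
  simp only [stdPicture, BlockPicture.canonicalData]
  rw [Finset.sum_pair (by decide), Finset.sum_pair (by decide), Finset.sum_pair (by decide),
    show ({{{0, 1}, {2, 3}}, {{4, 5}, {6, 7}}} : Finset (Finset (Finset (Fin 8)))).erase
      {{0, 1}, {2, 3}} = {{{4, 5}, {6, 7}}} by decide,
    show ({{{0, 1}, {2, 3}}, {{4, 5}, {6, 7}}} : Finset (Finset (Finset (Fin 8)))).erase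
      {{4, 5}, {6, 7}} = {{{0, 1}, {2, 3}}} by decide,
    Finset.sum_singleton, Finset.sum_singleton, Finset.sum_pair (by decide),
    Finset.sum_pair (by decide),
    show ({0, 1}ᶜ : Finset (Fin 8)) = {2, 3, 4, 5, 6, 7} by decide,
    show ({2, 3}ᶜ : Finset (Fin 8)) = {0, 1, 4, 5, 6, 7} by decide,
    show ({4, 5}ᶜ : Finset (Fin 8)) = {0, 1, 2, 3, 6, 7} by decide,
    show ({6, 7}ᶜ : Finset (Fin 8)) = {0, 1, 2, 3, 4, 5} by decide,
    add_comm (vPln {0, 1, 2, 3, 6, 7})]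

theorem canonicalData_phi2 : phi2a.stdPicture.canonicalData =
    (vLn {0, 1, 2} + vLn {5, 6, 7}) ⊔ (vPln {0, 1, 2, 3, 4} + vPln {3, 4, 5, 6, 7}) := by
  simp only [stdPicture, BlockPicture.canonicalData]
  rw [Finset.sum_pair (by decide), Finset.sum_pair (by decide),
    show ({0, 1, 2}ᶜ : Finset (Fin 8)) = {3, 4, 5, 6, 7} by decide,
    show ({5, 6, 7}ᶜ : Finset (Fin 8)) = {0, 1, 2, 3, 4} by decide,
    add_comm (vPln {3, 4, 5, 6, 7})]

theorem canonicalData_chi1 : chi1a.stdPicture.canonicalData =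
    vPt {0, 1} ⊔ (vPln {0, 1, 2, 3, 4} + vPln {0, 1, 5, 6, 7}) := by
  simp only [stdPicture, BlockPicture.canonicalData]
  rw [Finset.sum_pair (by decide)]
  rfl

theorem canonicalData_stdPicture_some : ∀ (k : BlockKind) (S : Quad),
    2 * k.stdPicture.canonicalData (some S) = (k.canonicalValue (indicator S.1) : ℚ)
  | alpha1a, S | alpha1b, S | alpha2a, S | alpha2b, S | chi2a, S | chi2b, S | chi2c, S
  | phi3a, S | phi3b, S | tcu, S | line, S => by
    simp [canonicalValue, value, stdPicture, BlockPicture.canonicalData, sum_halves,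
        vPt_some, vLn_some, vPln_some, Finset.sum_insert, ← add_assoc, vTc]
  | chi1a, S | chi1b, S | chi1c, S => by
    refine (congrArg (2 * ·) (congrFun canonicalData_chi1 (some S))).trans ?_
    simp [canonicalValue, value, vPt_some, vPln_some, Finset.sum_insert, ← add_assoc]
  | phi1a, S | phi1b, S => by
    refine (congrArg (2 * ·) (congrFun canonicalData_phi1 (some S))).trans ?_
    simp only [canonicalValue, value, Pi.smul_apply, Pi.add_apply, Pi.sup_apply, smul_eq_mul,
      vPt_some, vPln_some]
    simp [Finset.sum_insert, ← add_assoc]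
  | phi2a, S | phi2b, S | phi2c, S => by
    refine (congrArg (2 * ·) (congrFun canonicalData_phi2 (some S))).trans ?_
    simp only [canonicalValue, value, Pi.add_apply, Pi.sup_apply, vLn_some, vPln_some]
    simp [Finset.sum_insert, ← add_assoc]

theorem canonicalData_stdPicture_none : ∀ k : BlockKind,
    k.stdPicture.canonicalData none = k.stdData none
  | alpha1a | alpha1b | alpha2a | alpha2b | chi2a | chi2b | chi2c | phi3a | phi3b | line => by
    simp [stdPicture, stdData, BlockPicture.canonicalData, sum_halves, vPt, vLn, vPln]
  | tcu => rfl
  | chi1a | chi1b | chi1c =>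
    (congrFun canonicalData_chi1 none).trans (by simp [stdData, vPt, vLn, vPln])
  | phi1a | phi1b => (congrFun canonicalData_phi1 none).trans (by simp [stdData, vPt, vLn, vPln])
  | phi2a | phi2b | phi2c =>
    (congrFun canonicalData_phi2 none).trans (by simp [stdData, vPt, vLn, vPln])

/-- The constant term of an affine function relating `value` and `canonicalValue`. -/
def affineConstant : BlockKind → ℤ
  | alpha1a => 0
  | alpha1b => 2
  | alpha2a => 0
  | alpha2b => 6
  | chi1a => 2
  | chi1b => 0
  | chi1c => -2
  | chi2a => 6
  | chi2b => 0
  | chi2c => 2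
  | phi1a => 0
  | phi1b => 2
  | phi2a => 0
  | phi2b => 4
  | phi2c => -2
  | phi3a => 2
  | phi3b => 8
  | tcu => 0
  | line => 2

/-- The coefficients of an affine function relating `value` and `canonicalValue`. -/
def affineCoeff : BlockKind → Fin 8 → ℤ
  | alpha1a => ![0, 0, 0, 0, 0, 0, 0, 0]
  | alpha1b => ![-2, -2, 0, 0, 0, 0, 0, 0]
  | alpha2a => ![0, 0, 0, 0, 0, 0, 0, 0]
  | alpha2b => ![0, 0, 0, 0, -2, -2, -2, -2]
  | chi1a => ![-2, -2, 0, 0, 0, 0, 0, 0]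
  | chi1b => ![0, 0, 0, 0, 0, 0, 0, 0]
  | chi1c => ![0, 0, 2, 2, 2, 0, 0, 0]
  | chi2a => ![-4, -4, -4, 0, 0, 0, 0, 0]
  | chi2b => ![0, 0, 0, 0, 0, 0, 0, 0]
  | chi2c => ![-2, -2, -2, 0, 0, 0, 0, 0]
  | phi1a => ![1, 1, -1, -1, 0, 0, 0, 0]
  | phi1b => ![0, 0, 0, 0, -1, -1, -1, -1]
  | phi2a => ![0, 0, 0, 0, 0, 0, 0, 0]
  | phi2b => ![0, 0, 0, 0, 0, -2, -2, -2]
  | phi2c => ![2, 2, 2, 0, 0, 0, 0, 0]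
  | phi3a => ![0, 0, 0, 0, -1, -1, -1, -1]
  | phi3b => ![0, 0, 0, 0, -3, -3, -3, -3]
  | tcu => ![0, 0, 0, 0, 0, 0, 0, 0]
  | line => ![0, 0, 0, 0, -1, -1, -1, -1]

end BlockKind

/-! ### Evaluation at bit masks -/

/-- The binary digit of `s` at position `i`. -/
def maskBit (s i : ℕ) : ℕ := (s >>> i) % 2

/-- The set of labels whose binary digits in `s` are `1`. -/
def maskSet (s : ℕ) : Finset (Fin 8) := Finset.univ.filter fun i => s.testBit i

/-- The number of labels whose binary digits in `s` are `1`. -/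
def maskCard (s : ℕ) : ℕ :=
  maskBit s 0 + maskBit s 1 + maskBit s 2 + maskBit s 3 + maskBit s 4 + maskBit s 5 +
    maskBit s 6 + maskBit s 7

theorem mem_maskSet {s : ℕ} {i : Fin 8} : i ∈ maskSet s ↔ s.testBit i := by simp [maskSet]

theorem indicator_maskSet (s : ℕ) (i : Fin 8) : indicator (maskSet s) i = maskBit s i := by
  rw [indicator, maskBit, Nat.shiftRight_eq_div_pow, ← Nat.toNat_testBit]
  simp only [mem_maskSet]
  cases s.testBit i <;> rfl

theorem card_maskSet (s : ℕ) : (maskSet s).card = maskCard s := by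
  rw [← Finset.univ_inter (maskSet s), Finset.inter_comm, card_inter_eq_sum, Fin.sum_univ_eight]
  simp only [indicator_maskSet]
  rfl

theorem exists_maskSet (S : Finset (Fin 8)) : ∃ s < 256, S = maskSet s := by
  refine ⟨Nat.ofBits fun i : Fin 8 => decide (i ∈ S), Nat.ofBits_lt_two_pow _, ?_⟩
  ext i
  rw [mem_maskSet, Nat.testBit_ofBits_lt _ _ i.2]
  simp

/-! ### Affine equivalence of blocks with the same picture -/

namespace BlockKind

/-- The explicit affine functions are tested on the 70 four-element sets for all 19 kinds; masks of
other cardinality pass trivially. -/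
theorem affine_check : ([alpha1a, alpha1b, alpha2a, alpha2b, chi1a, chi1b, chi1c, chi2a, chi2b,
    chi2c, phi1a, phi1b, phi2a, phi2b, phi2c, phi3a, phi3b, tcu, line].all fun k =>
      (List.range 256).all fun s => maskCard s != 4 ||
        2 * (k.value fun i => maskBit s i : ℤ) = (k.canonicalValue fun i => maskBit s i) +
          (k.affineConstant + (maskBit s 0 * k.affineCoeff 0 + maskBit s 1 * k.affineCoeff 1 +
            maskBit s 2 * k.affineCoeff 2 + maskBit s 3 * k.affineCoeff 3 +
            maskBit s 4 * k.affineCoeff 4 + maskBit s 5 * k.affineCoeff 5 +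
            maskBit s 6 * k.affineCoeff 6 + maskBit s 7 * k.affineCoeff 7))) = true := by
  decide +kernel

theorem two_mul_value_eq (k : BlockKind) (S : Quad) :
    2 * (k.value (indicator S.1) : ℤ) = k.canonicalValue (indicator S.1) +
      (k.affineConstant + ∑ i ∈ S.1, k.affineCoeff i) := by
  have hmem : k ∈ [alpha1a, alpha1b, alpha2a, alpha2b, chi1a, chi1b, chi1c, chi2a, chi2b,
    chi2c, phi1a, phi1b, phi2a, phi2b, phi2c, phi3a, phi3b, tcu, line] := by
    cases k <;> simp
  obtain ⟨s, hs, e⟩ := exists_maskSet S.1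
  have h := List.all_eq_true.1 (List.all_eq_true.1 affine_check k hmem) s (List.mem_range.2 hs)
  have hc : maskCard s = 4 := by rw [← card_maskSet, ← e, S.2]
  simp only [hc, bne_self_eq_false, Bool.false_or, decide_eq_true_eq] at h
  have hsum : ∑ i ∈ S.1, k.affineCoeff i = ∑ i, (indicator S.1 i : ℤ) * k.affineCoeff i := by
    simp [indicator]
  rw [hsum, Fin.sum_univ_eight, e, funext (indicator_maskSet s)]
  exact h

theorem stdData_affinelyEquivalent (k : BlockKind) :
    ValData.AffinelyEquivalent k.stdData k.stdPicture.canonicalData := by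
  refine ⟨(canonicalData_stdPicture_none k).symm, k.affineConstant / 2,
    fun i => k.affineCoeff i / 2, fun S => ?_⟩
  have h := congrArg (Int.cast : ℤ → ℚ) (two_mul_value_eq k S)
  push_cast at h
  rw [stdData_some, ← Finset.sum_div]
  have h2 := canonicalData_stdPicture_some k S
  linarith

end BlockKind

namespace Block

theorem data_affinelyEquivalent_canonicalData (X : Block) :
    ValData.AffinelyEquivalent X.data X.picture.canonicalData := by
  rw [data, picture, BlockPicture.canonicalData_relabel]
  exact X.kind.stdData_affinelyEquivalent.relabel _

/-- Blocks with the same picture have affinely equivalent data. -/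
theorem data_affinelyEquivalent {X Y : Block} (h : X.picture = Y.picture) :
    ValData.AffinelyEquivalent X.data Y.data :=
  X.data_affinelyEquivalent_canonicalData.trans
    (h ▸ Y.data_affinelyEquivalent_canonicalData.symm)

end Block

/-! ### Blocks labelled by explicit permutations -/

/-- The permutation with underlying function `f`, if `f` is injective. -/
noncomputable def labelling (f : Fin 8 → Fin 8) : Equiv.Perm (Fin 8) :=
  if h : Function.Injective f then Equiv.ofBijective f (Finite.injective_iff_bijective.1 h) else 1

theorem coe_labelling {f : Fin 8 → Fin 8} (h : Function.Injective f) : ⇑(labelling f) = f := by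
  rw [labelling, dif_pos h]; rfl

namespace BlockPicture

/-- The image of a picture under a map between the labels. -/
def map (f : Fin 8 → Fin 8) : BlockPicture → BlockPicture
  | alpha1 T => alpha1 (T.image f)
  | alpha2 π => alpha2 (π.image (Finset.image f))
  | chi1 T π => chi1 (T.image f) (π.image (Finset.image f))
  | chi2 T => chi2 (T.image f)
  | phi1 π => phi1 (π.image (Finset.image (Finset.image f)))
  | phi2 π => phi2 (π.image (Finset.image f))
  | phi3 π => phi3 (π.image (Finset.image f))
  | tcu => tcu
  | line π => line (π.image (Finset.image f))

/-- `labelling` is noncomputable; passing to `map` makes equalities of pictures decidable by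
evaluation. -/
theorem relabel_labelling {f : Fin 8 → Fin 8} (h : Function.Injective f) (p : BlockPicture) :
    p.relabel (labelling f) = p.map f := by
  cases p <;> simp only [relabel, map, coe_labelling h]

theorem relabel_mul (σ τ : Equiv.Perm (Fin 8)) (p : BlockPicture) :
    p.relabel (σ * τ) = (p.relabel τ).relabel σ := by
  cases p <;> simp [relabel, Finset.image_image, Function.comp_def]

end BlockPicture

/-- The value of a labelled block at the set of labels with bit mask `s`. -/
def maskValue (k : BlockKind) (f : Fin 8 → Fin 8) (s : ℕ) : ℕ :=
  k.value fun i => maskBit s (f i)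

theorem data_labelling_some (k : BlockKind) {f : Fin 8 → Fin 8} (h : Function.Injective f)
    {S : Quad} {s : ℕ} (hs : S.1 = maskSet s) :
    Block.data ⟨k, labelling f⟩ (some S) = maskValue k f s := by
  rw [Block.data_some, coe_labelling h, hs]
  simp only [indicator_maskSet]
  rfl

theorem data_labelling_eval (k : BlockKind) {f : Fin 8 → Fin 8} (h : Function.Injective f)
    {S : Finset (Fin 8)} (hS : S.card = 4) {s : ℕ} (hs : S = maskSet s) :
    (Block.data ⟨k, labelling f⟩).eval S = maskValue k f s := by
  rw [ValData.eval_of_card _ hS, data_labelling_some k h hs]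

/-! ### Tropical Plücker relations for blocks -/

/-- The three-term tropical Plücker relations, for a function on bit masks. -/
def pluckerCheck (val : ℕ → ℕ) : Bool :=
  (List.range 8).all fun a => (List.range a).all fun b =>
  (List.range 8).all fun i => (i.beq a || i.beq b) ||
  (List.range i).all fun j => (j.beq a || j.beq b) ||
  (List.range i).all fun k => (k.beq a || k.beq b || k.beq j) ||
  (List.range k).all fun l => (l.beq a || l.beq b || l.beq j) ||
    ((val (2 ^ a ||| 2 ^ b ||| 2 ^ i ||| 2 ^ k) + val (2 ^ a ||| 2 ^ b ||| 2 ^ j ||| 2 ^ l)).ble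
      (val (2 ^ a ||| 2 ^ b ||| 2 ^ i ||| 2 ^ j) + val (2 ^ a ||| 2 ^ b ||| 2 ^ k ||| 2 ^ l)) ||
    (val (2 ^ a ||| 2 ^ b ||| 2 ^ i ||| 2 ^ l) + val (2 ^ a ||| 2 ^ b ||| 2 ^ j ||| 2 ^ k)).ble
      (val (2 ^ a ||| 2 ^ b ||| 2 ^ i ||| 2 ^ j) + val (2 ^ a ||| 2 ^ b ||| 2 ^ k ||| 2 ^ l)))

/-- The values of `val` at all bit masks, as the hexadecimal digits of one number. -/
def packValues (val : ℕ → ℕ) : ℕ :=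
  (List.range 256).foldr (fun s W => val s + 16 * W) 0

/-- The hexadecimal digit of `W` at position `s`. -/
def hexDigit (W s : ℕ) : ℕ := (W >>> (4 * s)) % 16

/-- `pluckerCheck` with tabulated values. -/
def packedPluckerCheck (val : ℕ → ℕ) : Bool :=
  ((List.range 256).all fun s => hexDigit (packValues val) s == val s) &&
    pluckerCheck (hexDigit (packValues val))

theorem four_eq_maskSet (a b i j : Fin 8) : ({a, b, i, j} : Finset (Fin 8)) =
    maskSet (2 ^ a.1 ||| 2 ^ b.1 ||| 2 ^ i.1 ||| 2 ^ j.1) := by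
  ext x
  simp [mem_maskSet, Nat.testBit_two_pow, Fin.ext_iff, eq_comm (a := x.1), or_assoc]

theorem four_mask_lt (a b i j : Fin 8) :
    2 ^ a.1 ||| 2 ^ b.1 ||| 2 ^ i.1 ||| 2 ^ j.1 < 256 := by
  have h : ∀ x : Fin 8, 2 ^ x.1 < 2 ^ 8 := fun x => Nat.pow_lt_pow_right (by simp) x.2
  exact Nat.or_lt_two_pow (Nat.or_lt_two_pow (Nat.or_lt_two_pow (h a) (h b)) (h i)) (h j)

theorem card_four {a b i j : Fin 8} (h : [a, b, i, j].Nodup) :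
    ({a, b, i, j} : Finset (Fin 8)).card = 4 := by
  have := List.toFinset_card_of_nodup h
  simpa using this

namespace ValData

theorem three_term_of_pluckerCheck {v : ValData} {val : ℕ → ℕ}
    (hv : ∀ (S : Finset (Fin 8)), S.card = 4 → ∀ s < 256, S = maskSet s → v.eval S = val s)
    (h : pluckerCheck val = true) {a b i j k l : Fin 8} (hn : [a, b, i, j, k, l].Nodup)
    (hab : b < a) (hij : j < i) (hkl : l < k) (hik : k < i) :
    min (v.eval {a, b, i, k} + v.eval {a, b, j, l}) (v.eval {a, b, i, l} + v.eval {a, b, j, k}) ≤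
      v.eval {a, b, i, j} + v.eval {a, b, k, l} := by
  simp only [pluckerCheck, List.all_eq_true, List.mem_range, Bool.or_eq_true, Nat.beq_eq,
    Nat.ble_eq, ← min_le_iff] at h
  simp only [List.nodup_cons, List.mem_cons, List.not_mem_nil, or_false, not_or,
      List.nodup_nil, not_false_eq_true, and_true] at hn
  obtain ⟨⟨_, hai, haj, hak, hal⟩, ⟨hbi, hbj, hbk, hbl⟩, ⟨_, _, hil⟩, ⟨hjk, hjl⟩, _⟩ := hn
  have h1 := (h a a.2 b hab i i.2).resolve_left (by rw [Fin.val_inj, Fin.val_inj]; grind)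
  have h2 := (h1 j hij).resolve_left (by rw [Fin.val_inj, Fin.val_inj]; grind)
  have h3 := (h2 k hik).resolve_left (by rw [Fin.val_inj, Fin.val_inj, Fin.val_inj]; grind)
  have h4 := (h3 l hkl).resolve_left (by rw [Fin.val_inj, Fin.val_inj, Fin.val_inj]; grind)
  have e : ∀ x y : Fin 8, [a, b, x, y].Nodup →
      v.eval {a, b, x, y} = (val (2 ^ a.1 ||| 2 ^ b.1 ||| 2 ^ x.1 ||| 2 ^ y.1) : ℚ) :=
    fun x y hxy => hv _ (card_four hxy) _ (four_mask_lt a b x y) (four_eq_maskSet a b x y)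
  rw [e i k (by simp; grind), e j l (by simp; grind), e i l (by simp; grind),
    e j k (by simp; grind), e i j (by simp; grind), e k l (by simp; grind)]
  exact_mod_cast h4

theorem isTropicalPlucker_of_pluckerCheck {v : ValData} {val : ℕ → ℕ}
    (hv : ∀ (S : Finset (Fin 8)), S.card = 4 → ∀ s < 256, S = maskSet s → v.eval S = val s)
    (h : pluckerCheck val = true) : v.IsTropicalPlucker := by
  have swap : ∀ a b x y : Fin 8, ({a, b, x, y} : Finset (Fin 8)) = {a, b, y, x} := by
    intro a b x y; rw [Finset.pair_comm x y]
  -- The relation is invariant under exchanging `a, b`, or `i, j`, or `k, l`, or the pairs `ij` and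
  -- `kl`. `pluckerCheck` tests one ordering per orbit, and the ordering assumptions are removed one
  -- at a time.
  have h1 : ∀ a b i j k l : Fin 8, [a, b, i, j, k, l].Nodup → b < a → j < i → l < k →
      min (v.eval {a, b, i, k} + v.eval {a, b, j, l})
        (v.eval {a, b, i, l} + v.eval {a, b, j, k}) ≤
          v.eval {a, b, i, j} + v.eval {a, b, k, l} := by
    intro a b i j k l hn hab hij hkl
    rcases lt_or_gt_of_ne (show k ≠ i by simp at hn; grind) with hik | hik
    · exact three_term_of_pluckerCheck hv h hn hab hij hkl hik
    · have := three_term_of_pluckerCheck hv h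
        (show [a, b, k, l, i, j].Nodup by simp at hn ⊢; grind) hab hkl hij hik
      rwa [swap a b k i, swap a b l j, swap a b k j, swap a b l i,
        add_comm (v.eval {a, b, j, k}), add_comm (v.eval {a, b, k, l})] at this
  have h2 : ∀ a b i j k l : Fin 8, [a, b, i, j, k, l].Nodup → b < a → j < i →
      min (v.eval {a, b, i, k} + v.eval {a, b, j, l})
        (v.eval {a, b, i, l} + v.eval {a, b, j, k}) ≤
          v.eval {a, b, i, j} + v.eval {a, b, k, l} := by
    intro a b i j k l hn hab hij
    rcases lt_or_gt_of_ne (show l ≠ k by simp at hn; grind) with hkl | hkl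
    · exact h1 a b i j k l hn hab hij hkl
    · have := h1 a b i j l k (by simp at hn ⊢; grind) hab hij hkl
      rwa [min_comm, swap a b l k] at this
  have h3 : ∀ a b i j k l : Fin 8, [a, b, i, j, k, l].Nodup → b < a →
      min (v.eval {a, b, i, k} + v.eval {a, b, j, l})
        (v.eval {a, b, i, l} + v.eval {a, b, j, k}) ≤
          v.eval {a, b, i, j} + v.eval {a, b, k, l} := by
    intro a b i j k l hn hab
    rcases lt_or_gt_of_ne (show j ≠ i by simp at hn; grind) with hij | hij
    · exact h2 a b i j k l hn hab hij
    · have := h2 a b j i k l (by simp at hn ⊢; grind) hab hij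
      rwa [min_comm, swap a b j i, add_comm (v.eval {a, b, j, l}),
        add_comm (v.eval {a, b, j, k})] at this
  intro a b i j k l hn
  rcases lt_or_gt_of_ne (show b ≠ a by simp at hn; grind) with hab | hab
  · exact h3 a b i j k l hn hab
  · have := h3 b a i j k l (by simp at hn ⊢; grind) hab
    simpa only [Finset.insert_comm b a] using this

theorem isTropicalPlucker_of_packedPluckerCheck {v : ValData} {val : ℕ → ℕ}
    (hv : ∀ (S : Finset (Fin 8)), S.card = 4 → ∀ s < 256, S = maskSet s → v.eval S = val s)
    (h : packedPluckerCheck val = true) : v.IsTropicalPlucker := by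
  simp only [packedPluckerCheck, Bool.and_eq_true, List.all_eq_true, List.mem_range,
    beq_iff_eq] at h
  refine isTropicalPlucker_of_pluckerCheck (fun S hS s hs e => ?_) h.2
  rw [h.1 s hs]
  exact hv S hS s hs e

end ValData

/-! ### Verification for single blocks and compatible pairs -/

namespace BlockKind

/-- One kind per type of picture suffices, since affine equivalence preserves the relations. -/
theorem plucker_check : ([alpha1a, alpha2a, chi1a, chi2b, phi1a, phi2b, phi3a, tcu, line].all
    fun k => packedPluckerCheck (maskValue k id)) = true := by
  decide +kernel

theorem exists_picture_eq (k : BlockKind) :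
    ∃ k' ∈ [alpha1a, alpha2a, chi1a, chi2b, phi1a, phi2b, phi3a, tcu, line],
      k'.stdPicture = k.stdPicture :=
  match k with
  | alpha1a | alpha1b => ⟨alpha1a, by simp, rfl⟩
  | alpha2a | alpha2b => ⟨alpha2a, by simp, rfl⟩
  | chi1a | chi1b | chi1c => ⟨chi1a, by simp, rfl⟩
  | chi2a | chi2b | chi2c => ⟨chi2b, by simp, rfl⟩
  | phi1a | phi1b => ⟨phi1a, by simp, rfl⟩
  | phi2a | phi2b | phi2c => ⟨phi2b, by simp, rfl⟩
  | phi3a | phi3b => ⟨phi3a, by simp, rfl⟩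
  | tcu => ⟨tcu, by simp, rfl⟩
  | line => ⟨line, by simp, rfl⟩

end BlockKind

namespace Block

theorem data_mul (k : BlockKind) (σ τ : Equiv.Perm (Fin 8)) :
    Block.data ⟨k, σ * τ⟩ = (Block.data ⟨k, τ⟩).relabel σ :=
  ValData.relabel_mul _ σ τ

theorem picture_mul (k : BlockKind) (σ τ : Equiv.Perm (Fin 8)) :
    Block.picture ⟨k, σ * τ⟩ = (Block.picture ⟨k, τ⟩).relabel σ :=
  BlockPicture.relabel_mul σ τ _

theorem data_isTropicalPlucker (X : Block) : X.data.IsTropicalPlucker := by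
  obtain ⟨k, hk, hp⟩ := X.kind.exists_picture_eq
  have h := List.all_eq_true.1 BlockKind.plucker_check k hk
  have h1 : (Block.data ⟨k, labelling id⟩).IsTropicalPlucker :=
    ValData.isTropicalPlucker_of_packedPluckerCheck
      (fun S hS s _ hs => data_labelling_eval k Function.injective_id hS hs) h
  -- The factor `(labelling id)⁻¹` cancels the labelling of the tested block, leaving exactly
  -- `X.labels`.
  have h2 := h1.relabel (X.labels * (labelling id)⁻¹)
  rw [← data_mul] at h2
  refine h2.of_affinelyEquivalent (data_affinelyEquivalent ?_)
  simp only [inv_mul_cancel_right, picture, hp]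

end Block

/-- Blocks, as kinds with a labelling, that realise `compatibleConfigurations`. -/
def compatibleBlocks : List ((BlockKind × (Fin 8 → Fin 8)) × (BlockKind × (Fin 8 → Fin 8))) :=
  [ ((.alpha1a, ![0, 7, 1, 2, 3, 4, 5, 6]), (.alpha1a, ![1, 2, 0, 3, 4, 5, 6, 7])),
    ((.alpha1a, ![0, 7, 1, 2, 3, 4, 5, 6]), (.alpha2a, ![0, 1, 2, 7, 3, 4, 5, 6])),
    ((.alpha2a, ![0, 5, 6, 7, 1, 2, 3, 4]), (.alpha2a, ![0, 1, 2, 7, 3, 4, 5, 6])),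
    ((.alpha1a, ![0, 1, 2, 3, 4, 5, 6, 7]), (.chi1a, ![0, 1, 2, 3, 4, 5, 6, 7])),
    ((.alpha1a, ![1, 2, 0, 3, 4, 5, 6, 7]), (.chi2b, ![1, 2, 3, 0, 4, 5, 6, 7])),
    ((.alpha2a, ![0, 5, 6, 7, 1, 2, 3, 4]), (.chi1a, ![0, 1, 2, 3, 4, 5, 6, 7])),
    ((.alpha1a, ![2, 3, 0, 1, 4, 5, 6, 7]), (.chi1a, ![0, 1, 2, 3, 4, 5, 6, 7])),
    ((.alpha2a, ![0, 1, 2, 7, 3, 4, 5, 6]), (.chi1a, ![0, 1, 2, 3, 4, 5, 6, 7])),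
    ((.alpha1a, ![0, 7, 1, 2, 3, 4, 5, 6]), (.chi2b, ![1, 2, 3, 0, 4, 5, 6, 7])),
    ((.alpha2a, ![0, 5, 6, 7, 1, 2, 3, 4]), (.chi2b, ![1, 2, 3, 0, 4, 5, 6, 7])),
    ((.chi1a, ![0, 7, 1, 2, 3, 4, 5, 6]), (.chi1a, ![1, 2, 0, 6, 7, 3, 4, 5])),
    ((.chi1a, ![0, 7, 1, 2, 3, 4, 5, 6]), (.chi2b, ![1, 2, 3, 0, 4, 5, 6, 7])),
    ((.chi2b, ![2, 3, 4, 0, 1, 5, 6, 7]), (.chi2b, ![5, 6, 7, 0, 1, 2, 3, 4])),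
    ((.phi1a, ![0, 7, 3, 4, 1, 2, 5, 6]), (.alpha1a, ![0, 7, 1, 2, 3, 4, 5, 6])),
    ((.phi1a, ![0, 7, 3, 4, 1, 2, 5, 6]), (.alpha2a, ![0, 1, 6, 7, 2, 3, 4, 5])),
    ((.phi2b, ![2, 3, 4, 0, 1, 5, 6, 7]), (.alpha1a, ![2, 3, 0, 1, 4, 5, 6, 7])),
    ((.phi2b, ![2, 3, 4, 0, 1, 5, 6, 7]), (.alpha2a, ![0, 1, 2, 3, 4, 5, 6, 7])),
    ((.phi3a, ![0, 1, 2, 7, 3, 4, 5, 6]), (.alpha1a, ![0, 7, 1, 2, 3, 4, 5, 6])),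
    ((.phi1a, ![0, 7, 3, 4, 1, 2, 5, 6]), (.chi1a, ![0, 7, 1, 2, 3, 4, 5, 6])),
    ((.phi2b, ![0, 6, 7, 4, 5, 1, 2, 3]), (.chi1a, ![0, 7, 1, 2, 3, 4, 5, 6])),
    ((.phi2b, ![2, 3, 4, 0, 1, 5, 6, 7]), (.chi2b, ![5, 6, 7, 0, 1, 2, 3, 4])),
    ((.phi3a, ![0, 5, 6, 7, 1, 2, 3, 4]), (.chi2b, ![1, 2, 3, 0, 4, 5, 6, 7])),
    ((.tcu, ![0, 1, 2, 3, 4, 5, 6, 7]), (.alpha1a, ![0, 1, 2, 3, 4, 5, 6, 7])),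
    ((.line, ![0, 1, 2, 3, 4, 5, 6, 7]), (.alpha1a, ![0, 1, 2, 3, 4, 5, 6, 7])),
    ((.line, ![0, 1, 2, 3, 4, 5, 6, 7]), (.alpha2a, ![0, 5, 6, 7, 1, 2, 3, 4])),
    ((.tcu, ![0, 1, 2, 3, 4, 5, 6, 7]), (.chi2b, ![0, 1, 2, 3, 4, 5, 6, 7])),
    ((.line, ![0, 1, 2, 3, 4, 5, 6, 7]), (.chi1a, ![0, 1, 2, 3, 4, 5, 6, 7])),
    ((.line, ![0, 1, 2, 3, 4, 5, 6, 7]), (.chi2b, ![0, 1, 2, 3, 4, 5, 6, 7])) ]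

theorem compatibleConfigurations_eq : BlockPicture.compatibleConfigurations =
    compatibleBlocks.map fun c =>
      (c.1.1.stdPicture.map c.1.2, c.2.1.stdPicture.map c.2.2) := by
  simp only [BlockPicture.compatibleConfigurations, compatibleBlocks, List.map,
    BlockKind.stdPicture, BlockPicture.map, List.cons.injEq, Prod.mk.injEq,
    BlockPicture.alpha1.injEq, BlockPicture.alpha2.injEq, BlockPicture.chi1.injEq,
    BlockPicture.chi2.injEq, BlockPicture.phi1.injEq, BlockPicture.phi2.injEq,
    BlockPicture.phi3.injEq, BlockPicture.line.injEq]
  repeat' apply And.intro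
  all_goals decide

theorem compatibleBlocks_injective :
    ∀ c ∈ compatibleBlocks, Function.Injective c.1.2 ∧ Function.Injective c.2.2 := by
  decide +kernel

/-- The combinatorial content of compatibility: one representative pair per configuration is tested,
and affine equivalence and relabelling give all others. -/
theorem compatibleBlocks_plucker_check : (compatibleBlocks.all fun c =>
    packedPluckerCheck fun s => maskValue c.1.1 c.1.2 s + maskValue c.2.1 c.2.2 s) = true := by
  decide +kernel

theorem exists_blocks_of_mem_compatibleConfigurations {c : BlockPicture × BlockPicture}
    (hc : c ∈ BlockPicture.compatibleConfigurations) : ∃ X Y : Block,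
      X.picture = c.1 ∧ Y.picture = c.2 ∧ (X.data + Y.data).IsTropicalPlucker := by
  rw [compatibleConfigurations_eq, List.mem_map] at hc
  obtain ⟨d, hd, rfl⟩ := hc
  obtain ⟨h1, h2⟩ := compatibleBlocks_injective d hd
  refine ⟨⟨d.1.1, labelling d.1.2⟩, ⟨d.2.1, labelling d.2.2⟩,
    BlockPicture.relabel_labelling h1 _, BlockPicture.relabel_labelling h2 _,
    ValData.isTropicalPlucker_of_packedPluckerCheck (fun S hS s _ hs => ?_)
      (List.all_eq_true.1 compatibleBlocks_plucker_check d hd)⟩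
  rw [ValData.eval_add, data_labelling_eval _ h1 hS hs, data_labelling_eval _ h2 hS hs]
  push_cast
  rfl

/-- The sum of the data of two blocks with compatible pictures satisfies the tropical Plücker
relations. -/
theorem Block.data_add_isTropicalPlucker {X Y : Block}
    (h : X.picture.Compatible Y.picture) : (X.data + Y.data).IsTropicalPlucker := by
  rcases h with h | ⟨c, hc, σ, h⟩
  · exact X.data_isTropicalPlucker.add_self.of_affinelyEquivalent
      ((ValData.AffinelyEquivalent.refl _).add (data_affinelyEquivalent h))
  obtain ⟨X', Y', hX, hY, hP⟩ := exists_blocks_of_mem_compatibleConfigurations hc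
  have hP := hP.relabel σ
  rw [ValData.relabel_add] at hP
  rw [← hX, ← hY] at h
  have key : ∀ Z Z' : Block, Z.picture = Z'.picture.relabel σ →
      ValData.AffinelyEquivalent (Z'.data.relabel σ) Z.data := by
    intro Z Z' h
    have : Z'.data.relabel σ = Block.data ⟨Z'.kind, σ * Z'.labels⟩ := (data_mul _ _ _).symm
    rw [this]
    exact data_affinelyEquivalent ((picture_mul _ _ _).trans h.symm)
  rcases h with ⟨h1, h2⟩ | ⟨h1, h2⟩
  · exact hP.of_affinelyEquivalent ((key _ _ h1).add (key _ _ h2))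
  · rw [add_comm]
    exact hP.of_affinelyEquivalent ((key _ _ h1).add (key _ _ h2))

/-! ### Normalised blocks with a given picture -/

namespace BlockKind

/-- The blocks with the same picture as the standard labelled block of a given kind. -/
def variants : BlockKind → List (BlockKind × (Fin 8 → Fin 8))
  | alpha1a | alpha1b => [(alpha1a, id), (alpha1b, id)]
  | alpha2a | alpha2b => [(alpha2a, id), (alpha2b, id), (alpha2b, ![4, 5, 6, 7, 0, 1, 2, 3])]
  | chi1a | chi1b | chi1c =>
    [(chi1a, id), (chi1b, id), (chi1c, id), (chi1c, ![0, 1, 5, 6, 7, 2, 3, 4])]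
  | chi2a | chi2b | chi2c => [(chi2a, id), (chi2b, id), (chi2c, id)]
  | phi1a | phi1b =>
    [(phi1a, id), (phi1a, ![2, 3, 0, 1, 4, 5, 6, 7]), (phi1a, ![4, 5, 6, 7, 0, 1, 2, 3]),
      (phi1a, ![6, 7, 4, 5, 0, 1, 2, 3]), (phi1b, id), (phi1b, ![4, 5, 6, 7, 0, 1, 2, 3])]
  | phi2a | phi2b | phi2c =>
    [(phi2a, id), (phi2b, id), (phi2b, ![5, 6, 7, 3, 4, 0, 1, 2]), (phi2c, id),
      (phi2c, ![5, 6, 7, 3, 4, 0, 1, 2])]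
  | phi3a | phi3b =>
    [(phi3a, id), (phi3a, ![4, 5, 6, 7, 0, 1, 2, 3]), (phi3b, id),
      (phi3b, ![4, 5, 6, 7, 0, 1, 2, 3])]
  | tcu => [(tcu, id)]
  | line => [(line, id), (line, ![4, 5, 6, 7, 0, 1, 2, 3])]

theorem variants_injective (k : BlockKind) : ∀ p ∈ k.variants, Function.Injective p.2 := by
  cases k <;> decide +kernel

theorem variants_picture (k : BlockKind) :
    ∀ p ∈ k.variants, p.1.stdPicture.map p.2 = k.stdPicture := by
  cases k <;>
    simp only [variants, List.forall_mem_cons, List.not_mem_nil, IsEmpty.forall_iff,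
      implies_true, and_true, stdPicture, BlockPicture.map,
      BlockPicture.alpha1.injEq, BlockPicture.alpha2.injEq, BlockPicture.chi1.injEq,
      BlockPicture.chi2.injEq, BlockPicture.phi1.injEq, BlockPicture.phi2.injEq,
      BlockPicture.phi3.injEq, BlockPicture.line.injEq] <;>
    decide +kernel

end BlockKind

/-- `ValData.IsNormalisedAt`, for a function on bit masks. -/
def normalisedCheck (f : ℕ) (val : ℕ → ℕ) : Bool :=
  ((List.range 8).all fun i => maskBit f i == 0 || val (f ^^^ 2 ^ i) == 0) &&
  ((List.range 8).all fun i => maskBit f i == 1 ||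
    (List.range 8).any fun j => maskBit f j == 1 && (List.range j).any fun k =>
      maskBit f k == 1 && val ((2 ^ i ||| f) ^^^ (2 ^ j ||| 2 ^ k)) == 0)

/-- For each of the 56 possible frames, some block with the given picture is normalised there. This
is why one picture needs several kinds of blocks, and why `variants` also applies symmetries of the
picture. -/
theorem variants_normalisedCheck (k : BlockKind) :
    ((List.range 256).all fun f => maskCard f != 5 ||
      k.variants.any fun p => normalisedCheck f (maskValue p.1 p.2)) = true := by
  -- The list `variants` depends only on the picture, so nine kinds are enough.
  have h : ([BlockKind.alpha1a, .alpha2a, .chi1a, .chi2a, .phi1a, .phi2a, .phi3a, .tcu,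
      .line].all fun k => (List.range 256).all fun f => maskCard f != 5 ||
      k.variants.any fun p => normalisedCheck f (maskValue p.1 p.2)) = true := by
    decide +kernel
  simp only [List.all_cons, List.all_nil, Bool.and_true, Bool.and_eq_true] at h
  obtain ⟨h1, h2, h3, h4, h5, h6, h7, h8, h9⟩ := h
  match k with
  | .alpha1a | .alpha1b => exact h1
  | .alpha2a | .alpha2b => exact h2
  | .chi1a | .chi1b | .chi1c => exact h3
  | .chi2a | .chi2b | .chi2c => exact h4
  | .phi1a | .phi1b => exact h5
  | .phi2a | .phi2b | .phi2c => exact h6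
  | .phi3a | .phi3b => exact h7
  | .tcu => exact h8
  | .line => exact h9

theorem mem_maskSet_iff_maskBit {s : ℕ} {i : Fin 8} : i ∈ maskSet s ↔ maskBit s i = 1 := by
  rw [← indicator_maskSet]; simp [indicator]

theorem isNormalisedAt_of_normalisedCheck (k : BlockKind) {g : Fin 8 → Fin 8}
    (hg : Function.Injective g) {f : ℕ} (hf : (maskSet f).card = 5)
    (h : normalisedCheck f (maskValue k g) = true) :
    (Block.data ⟨k, labelling g⟩).IsNormalisedAt (maskSet f) := by
  simp only [normalisedCheck, Bool.and_eq_true, List.all_eq_true, List.any_eq_true,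
    List.mem_range, Bool.or_eq_true, beq_iff_eq] at h
  obtain ⟨h1, h2⟩ := h
  refine ⟨Block.data_nonneg _, fun S hS => ?_, fun i hi => ?_⟩
  · have hc : (maskSet f \ S.1).card = 1 := by rw [Finset.card_sdiff_of_subset hS, hf, S.2]
    obtain ⟨i, hi⟩ := Finset.card_eq_one.1 hc
    have hi' : i ∈ maskSet f \ S.1 := by simp [hi]
    have h3 : ¬ maskBit f i = 0 := by
      have := mem_maskSet_iff_maskBit.1 (Finset.mem_sdiff.1 hi').1
      omega
    have e : S.1 = maskSet (f ^^^ 2 ^ i.1) := by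
      rw [← Finset.sdiff_sdiff_eq_self hS, hi]
      ext x
      have hfi := mem_maskSet.1 (Finset.mem_sdiff.1 hi').1
      simp only [Finset.mem_sdiff, Finset.mem_singleton, mem_maskSet, Nat.testBit_xor,
        Nat.testBit_two_pow, Fin.val_inj]
      by_cases hx : x = i
      · subst hx; simp [hfi]
      · simp [hx, Ne.symm hx]
    rw [data_labelling_some k hg e, (h1 i i.2).resolve_left h3]
    rfl
  · obtain ⟨j, hj, hfj, l, hl, hfl, h3⟩ := (h2 i i.2).resolve_left
      (fun h => hi (mem_maskSet_iff_maskBit.2 h))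
    lift j to Fin 8 using hj
    lift l to Fin 8 using hl.trans j.2
    have hj := (mem_maskSet_iff_maskBit (i := j)).2 hfj
    have hl' := (mem_maskSet_iff_maskBit (i := l)).2 hfl
    have hjl : j ≠ l := fun h => by simp [h] at hl
    have e : insert i (maskSet f \ {j, l}) =
        maskSet ((2 ^ i.1 ||| f) ^^^ (2 ^ j.1 ||| 2 ^ l.1)) := by
      ext x
      have hfi : f.testBit i = false := by simpa [mem_maskSet] using hi
      have hfj := mem_maskSet.1 hj
      have hfl := mem_maskSet.1 hl'
      simp only [Finset.mem_insert, Finset.mem_sdiff, Finset.mem_singleton, mem_maskSet,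
        Nat.testBit_xor, Nat.testBit_or, Nat.testBit_two_pow, Fin.val_inj]
      by_cases hxj : x = j
      · subst hxj; simp [hfj]; grind
      by_cases hxl : x = l
      · subst hxl; simp [hfl]; grind
      · simp [hxj, hxl, Ne.symm hxj, Ne.symm hxl, eq_comm (a := x)]
    have hc := ValData.card_insert_sdiff_pair hf hi hj hl' hjl
    refine ⟨⟨_, hc⟩, by simp, Finset.insert_subset_insert _ Finset.sdiff_subset, ?_⟩
    rw [data_labelling_some k hg e, h3]
    rfl

/-- Every picture of a block is the picture of a block that is normalised at a given frame. -/
theorem Block.exists_isNormalisedAt (X : Block) {F : Finset (Fin 8)} (hF : F.card = 5) :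
    ∃ Y : Block, Y.picture = X.picture ∧ Y.data.IsNormalisedAt F := by
  -- Pulling the frame back along the labelling reduces to the standard labelled picture.
  obtain ⟨f, hf, e⟩ := exists_maskSet (F.map X.labels.symm.toEmbedding)
  have hc : maskCard f = 5 := by rw [← card_maskSet, ← e, Finset.card_map, hF]
  have h := List.all_eq_true.1 (variants_normalisedCheck X.kind) f (List.mem_range.2 hf)
  simp only [hc, bne_self_eq_false, Bool.false_or, List.any_eq_true] at h
  obtain ⟨p, hp, h⟩ := h
  have hinj := X.kind.variants_injective p hp
  refine ⟨⟨p.1, X.labels * labelling p.2⟩, ?_, ?_⟩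
  · rw [picture_mul, picture, picture, BlockPicture.relabel_labelling hinj,
      X.kind.variants_picture p hp]
  · rw [data_mul]
    have := (isNormalisedAt_of_normalisedCheck p.1 hinj
      (by rw [card_maskSet, hc]) h).relabel X.labels
    rw [← e] at this
    convert this
    ext x; simp

/-! ### Block decompositions under renormalisation -/

/-- A compatible block decomposition can be renormalised at another frame, keeping the picture. -/
theorem IsCompatibleDecomposition.exists_of_affinelyEquivalent {v v' : ValData}
    {B b : Finset Block} (h : IsCompatibleDecomposition v B b) {F : Finset (Fin 8)}
    (hF : F.card = 5) (hv' : v'.IsNormalisedAt F) (hvv' : ValData.AffinelyEquivalent v v') :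
    ∃ B' b', IsCompatibleDecomposition v' B' b' ∧ overlay B' = overlay B := by
  classical
  choose n hn1 hn2 using fun X : Block => X.exists_isNormalisedAt hF
  obtain ⟨m, l, hm, hl, hsum⟩ := h.sum_eq
  have hpl : ∀ X Y : Block, X.picture.Compatible Y.picture →
      ((n X).data + (n Y).data).IsTropicalPlucker := fun X Y hXY =>
    Block.data_add_isTropicalPlucker (by rwa [hn1, hn1])
  have haff : ∀ X : Block, ValData.AffinelyEquivalent (n X).data X.data := fun X =>
    Block.data_affinelyEquivalent (hn1 X)
  have hu : v' = ∑ X ∈ B, m X • (n X).data + ∑ Y ∈ b, l Y • (n Y).data := by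
    refine hv'.eq_of_affinelyEquivalent hF ⟨fun S => ?_, fun S hS => ?_, fun i hi => ?_⟩ ?_
    · simp only [Pi.add_apply, Finset.sum_apply, Pi.smul_apply, smul_eq_mul]
      exact add_nonneg
        (Finset.sum_nonneg fun X hX => mul_nonneg (hm X hX).le (Block.data_nonneg _ _))
        (Finset.sum_nonneg fun Y hY => mul_nonneg (hl Y hY) (Block.data_nonneg _ _))
    · simp [Finset.sum_apply, (hn2 _).frame S hS]
    -- Blocks in `B` are pairwise compatible and blocks in `b` have equal pictures; no relation
    -- between the two families is needed.
    · obtain ⟨S, h1, h2, h3, h4⟩ := ValData.exists_common_zero hF B b (fun X => (n X).data)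
        (fun X _ => hn2 X) (fun X hX Y hY => hpl X Y (h.compatible X hX Y hY))
        (fun X _ => hn2 X) (fun X hX Y hY => hpl X Y (Or.inl (h.auxiliary_same X hX Y hY))) hi
      refine ⟨S, h1, h2, ?_⟩
      simp only [Pi.add_apply, Finset.sum_apply, Pi.smul_apply, smul_eq_mul]
      rw [Finset.sum_eq_zero fun X hX => by rw [h3 X hX, mul_zero],
        Finset.sum_eq_zero fun X hX => by rw [h4 X hX, mul_zero], add_zero]
    · refine hvv'.symm.trans ?_
      rw [hsum]
      exact (ValData.AffinelyEquivalent.sum B fun X _ => (haff X).symm.smul _).add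
        (ValData.AffinelyEquivalent.sum b fun X _ => (haff X).symm.smul _)
  -- Distinct blocks may have the same replacement, so `n` need not be injective and coefficients
  -- are added along its fibres.
  have hfib : ∀ (s : Finset Block) (a : Block → ℚ), ∑ X ∈ s, a X • (n X).data =
      ∑ Y ∈ s.image n, (∑ X ∈ s with n X = Y, a X) • Y.data := by
    intro s a
    rw [← Finset.sum_fiberwise_of_maps_to (fun X hX => Finset.mem_image_of_mem n hX)]
    refine Finset.sum_congr rfl fun Y _ => ?_
    rw [Finset.sum_smul]
    refine Finset.sum_congr rfl fun X hX => ?_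
    rw [(Finset.mem_filter.1 hX).2]
  refine ⟨B.image n, b.image n, ⟨⟨fun Y => ∑ X ∈ B with n X = Y, m X,
    fun Y => ∑ X ∈ b with n X = Y, l X, ?_, ?_, ?_⟩, ?_, ?_, ?_⟩, ?_⟩
  · intro Y hY
    obtain ⟨X, hX, rfl⟩ := Finset.mem_image.1 hY
    exact Finset.sum_pos (fun Z hZ => hm Z (Finset.mem_filter.1 hZ).1)
      ⟨X, Finset.mem_filter.2 ⟨hX, rfl⟩⟩
  · intro Y _
    exact Finset.sum_nonneg fun Z hZ => hl Z (Finset.mem_filter.1 hZ).1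
  · rw [hu, hfib, hfib]
  · simp only [Finset.forall_mem_image, hn1]
    exact h.compatible
  · simp only [Finset.forall_mem_image, Finset.exists_mem_image, hn1]
    exact h.auxiliary
  · simp only [Finset.forall_mem_image, hn1]
    exact h.auxiliary_same
  · simp only [overlay, Finset.exists_mem_image, hn1]

/-! ### Brackets of lifts of octads -/

section Brackets

variable {F : Type*} [Field F]

/-- The determinant of the coordinate vectors of four labelled points. -/
def minorDet (x : Fin 8 → Fin 4 → F) (e : Fin 4 → Fin 8) : F :=
  Matrix.det (Matrix.of fun r c => x (e c) r)

theorem minorDet_smul_mulVec (x : Fin 8 → Fin 4 → F) (G : Matrix (Fin 4) (Fin 4) F)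
    (μ : Fin 8 → F) (e : Fin 4 → Fin 8) :
    minorDet (fun i => μ i • G.mulVec (x i)) e = (∏ c, μ (e c)) * (G.det * minorDet x e) := by
  rw [minorDet, minorDet, ← Matrix.det_mul, ← Matrix.det_mul_row]
  congr 1

theorem plucker_smul_mulVec (x : Fin 8 → Fin 4 → F) (G : Matrix (Fin 4) (Fin 4) F)
    (μ : Fin 8 → F) (S : Quad) :
    plucker (fun i => μ i • G.mulVec (x i)) S = (∏ i ∈ S.1, μ i) * (G.det * plucker x S) := by
  refine (minorDet_smul_mulVec x G μ _).trans ?_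
  congr 1
  conv_rhs => rw [← Finset.map_orderEmbOfFin_univ S.1 S.2, Finset.prod_map]
  rfl

theorem bracket_smul_mulVec (x : Fin 8 → Fin 4 → F) (G : Matrix (Fin 4) (Fin 4) F)
    (μ : Fin 8 → F) (i j k l : Fin 8) :
    bracket (fun i => μ i • G.mulVec (x i)) i j k l =
      (μ i * μ j * μ k * μ l) * (G.det * bracket x i j k l) := by
  refine (minorDet_smul_mulVec x G μ _).trans ?_
  rw [Fin.prod_univ_four]
  rfl

/-- The factor by which the cubic terms change under scaling and a linear map. -/
def cubicFactor (G : Matrix (Fin 4) (Fin 4) F) (μ : Fin 8 → F) (σ : Equiv.Perm (Fin 8)) : F :=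
  G.det ^ 4 * μ (σ 6) ^ 4 *
    (μ (σ 0) * μ (σ 1) * μ (σ 2) * μ (σ 3) * μ (σ 4) * μ (σ 5)) ^ 2

/-- In each of the two terms, `σ 6` occurs four times, the labels `σ 0, …, σ 5` twice, and `σ 7` not
at all. -/
theorem cubicTermLeft_smul_mulVec (x : Fin 8 → Fin 4 → F) (G : Matrix (Fin 4) (Fin 4) F)
    (μ : Fin 8 → F) (σ : Equiv.Perm (Fin 8)) :
    cubicTermLeft (fun i => μ i • G.mulVec (x i)) σ = cubicFactor G μ σ * cubicTermLeft x σ := by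
  simp only [cubicTermLeft, bracket_smul_mulVec, cubicFactor]
  ring

theorem cubicTermRight_smul_mulVec (x : Fin 8 → Fin 4 → F) (G : Matrix (Fin 4) (Fin 4) F)
    (μ : Fin 8 → F) (σ : Equiv.Perm (Fin 8)) :
    cubicTermRight (fun i => μ i • G.mulVec (x i)) σ =
      cubicFactor G μ σ * cubicTermRight x σ := by
  simp only [cubicTermRight, bracket_smul_mulVec, cubicFactor]
  ring

variable (ν : AddValuation F (WithTop ℚ))

theorem exists_coe_eq_of_ne_zero {a : F} (h : a ≠ 0) : ∃ q : ℚ, ν a = q := by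
  obtain ⟨q, hq⟩ := WithTop.ne_top_iff_exists.1 ((ν.ne_top_iff (x := a)).2 h)
  exact ⟨q, hq.symm⟩

theorem map_prod_eq_coe_sum {ι : Type*} (s : Finset ι) {a : ι → F} {w : ι → ℚ}
    (h : ∀ i ∈ s, ν (a i) = w i) : ν (∏ i ∈ s, a i) = ((∑ i ∈ s, w i : ℚ) : WithTop ℚ) := by
  classical
  induction s using Finset.induction_on with
  | empty => simp
  | insert i s hi ih =>
    rw [Finset.prod_insert hi, Finset.sum_insert hi, ν.map_mul, h i (by simp),
      ih fun j hj => h j (by simp [hj])]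
    rfl

theorem IsTwistedCubicIndex.smul_mulVec {x : Fin 8 → Fin 4 → F} {t : ℚ}
    (h : IsTwistedCubicIndex ν x t) {G : Matrix (Fin 4) (Fin 4) F} {μ : Fin 8 → F} :
    IsTwistedCubicIndex ν (fun i => μ i • G.mulVec (x i)) t := by
  have key : ∀ (κ a b : F), (t : WithTop ℚ) + min (ν (κ * a)) (ν (κ * b)) =
      ν κ + (t + min (ν a) (ν b)) := by
    intro κ a b
    rw [ν.map_mul, ν.map_mul, min_add_add_left, add_left_comm]
  obtain ⟨h1, σ, h2⟩ := h
  refine ⟨fun σ => ?_, σ, ?_⟩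
  · rw [cubicTermLeft_smul_mulVec, cubicTermRight_smul_mulVec, key, ← mul_sub, ν.map_mul]
    exact add_le_add le_rfl (h1 σ)
  · rw [cubicTermLeft_smul_mulVec, cubicTermRight_smul_mulVec, key, ← mul_sub, ν.map_mul, h2]

/-- A change of coordinates and a rescaling of coordinate vectors change the valuations of the
Plücker coordinates by an affine function. -/
theorem exists_affinelyEquivalent_smul_mulVec {x : Fin 8 → Fin 4 → F} {v : ValData}
    (hv : ∀ S : Quad, ν (plucker x S) = (v (some S) : WithTop ℚ))
    (ht : IsTwistedCubicIndex ν x (v none)) {G : Matrix (Fin 4) (Fin 4) F} (hG : G.det ≠ 0)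
    {μ : Fin 8 → F} (hμ : ∀ i, μ i ≠ 0) :
    ∃ v' : ValData, ValData.AffinelyEquivalent v v' ∧
      (∀ S : Quad, ν (plucker (fun i => μ i • G.mulVec (x i)) S) =
        (v' (some S) : WithTop ℚ)) ∧
      IsTwistedCubicIndex ν (fun i => μ i • G.mulVec (x i)) (v' none) := by
  obtain ⟨c, hc⟩ := exists_coe_eq_of_ne_zero ν hG
  choose w hw using fun i => exists_coe_eq_of_ne_zero ν (hμ i)
  refine ⟨fun S => S.elim (v none) fun S => v (some S) + (c + ∑ i ∈ S.1, w i),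
    ValData.AffinelyEquivalent.symm ⟨rfl, c, w, fun S => rfl⟩, fun S => ?_, ht.smul_mulVec ν⟩
  rw [plucker_smul_mulVec, ν.map_mul, ν.map_mul, hc, hv, map_prod_eq_coe_sum ν _ fun i _ => hw i]
  simp only [Option.elim_some]
  rw [← WithTop.coe_add, ← WithTop.coe_add]
  congr 1
  ring

theorem map_sign (σ : Equiv.Perm (Fin 4)) : ν ((Equiv.Perm.sign σ : ℤ) : F) = 0 := by
  rcases Int.units_eq_one_or (Equiv.Perm.sign σ) with h | h <;> simp [h]

/-- Up to sign, the Plücker coordinate does not depend on the order of the labels. -/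
theorem map_plucker_eq (x : Fin 8 → Fin 4 → F) (S : Quad) {e : Fin 4 → Fin 8}
    (he : Function.Injective e) (hS : ∀ c, e c ∈ S.1) : ν (plucker x S) = ν (minorDet x e) := by
  have hinj : Function.Injective fun c => (S.1.orderIsoOfFin S.2).symm ⟨e c, hS c⟩ := by
    intro c d hcd
    simpa [he.eq_iff] using hcd
  let σ : Equiv.Perm (Fin 4) := Equiv.ofBijective _ (Finite.injective_iff_bijective.1 hinj)
  have hσ : ∀ c, S.1.orderEmbOfFin S.2 (σ c) = e c := by
    intro c
    simp [σ, ← Finset.coe_orderIsoOfFin_apply]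
  have h := Matrix.det_permute' σ (Matrix.of fun r c => x (S.1.orderEmbOfFin S.2 c) r)
  have h' : (Matrix.of fun r c => x (S.1.orderEmbOfFin S.2 c) r).submatrix id σ =
      Matrix.of fun r c => x (e c) r := by
    ext r c
    simp [hσ]
  rw [h'] at h
  rw [minorDet, h, ν.map_mul, map_sign, zero_add]
  rfl

theorem map_prod_nonneg {ι : Type*} (s : Finset ι) {a : ι → F} (h : ∀ i ∈ s, 0 ≤ ν (a i)) :
    0 ≤ ν (∏ i ∈ s, a i) :=
  Finset.prod_induction _ (fun y => 0 ≤ ν y)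
    (fun a b ha hb => by rw [ν.map_mul]; exact add_nonneg ha hb) (by simp) h

theorem map_minorDet_nonneg {x : Fin 8 → Fin 4 → F} (hx : ∀ i j, 0 ≤ ν (x i j))
    (e : Fin 4 → Fin 8) : 0 ≤ ν (minorDet x e) := by
  rw [minorDet, Matrix.det_apply']
  refine ν.map_le_sum fun σ _ => ?_
  rw [ν.map_mul, map_sign, zero_add]
  exact map_prod_nonneg ν _ fun i _ => hx _ _

end Brackets

/-! ### Valuation data of normalised octads -/

section Normalised

variable {F : Type*} [Field F]

theorem det_standardFrame (a : Fin 5) :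
    Matrix.det (Matrix.of fun r c => standardFrame F (a.succAbove c) r) = 1 ∨
      Matrix.det (Matrix.of fun r c => standardFrame F (a.succAbove c) r) = -1 := by
  fin_cases a <;>
    simp [Matrix.det_succ_row_zero, Fin.sum_univ_succ, standardFrame, Fin.succAbove]
  exact Or.inr (by ring)

theorem standardFrame_eq_zero_or_one (a : Fin 5) (j : Fin 4) :
    standardFrame F a j = 0 ∨ standardFrame F a j = 1 := by
  fin_cases a <;> fin_cases j <;> simp [standardFrame]

theorem standardFrame_castSucc (c r : Fin 4) :
    standardFrame F c.castSucc r = (1 : Matrix (Fin 4) (Fin 4) F) r c := by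
  fin_cases c <;> fin_cases r <;> simp [standardFrame]

variable (ν : AddValuation F (WithTop ℚ))

theorem IsNormalisedLift.exists_frame {O : Octad F} {x : Fin 8 → Fin 4 → F}
    (hx : IsNormalisedLift ν O x) {s : Fin 5 ↪ Fin 8}
    (hs : ∀ i, ∃ h : standardFrame F i ≠ 0,
      O (s i) = Projectivization.mk F (standardFrame F i) h) (a : Fin 5) :
    ∃ c : F, ν c = 0 ∧ x (s a) = c • standardFrame F a := by
  obtain ⟨⟨h0, h1⟩, -, j, hj⟩ := hx (s a)
  obtain ⟨h2, h3⟩ := hs a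
  rw [h3, Projectivization.mk_eq_mk_iff'] at h1
  obtain ⟨c, hc⟩ := h1
  refine ⟨c, ?_, hc.symm⟩
  rw [← hc] at hj
  rcases standardFrame_eq_zero_or_one (F := F) a j with h | h
  -- A zero coordinate has valuation `⊤`, so the coordinate of valuation `0` is one where the frame
  -- vector is `1`.
  · simp [h] at hj
  · simpa [h] using hj

/-- The valuation data of an octad with five points in standard position are normalised. -/
theorem IsNormalisedLift.isNormalisedAt {O : Octad F} {x : Fin 8 → Fin 4 → F}
    (hx : IsNormalisedLift ν O x) {s : Fin 5 ↪ Fin 8}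
    (hs : ∀ i, ∃ h : standardFrame F i ≠ 0,
      O (s i) = Projectivization.mk F (standardFrame F i) h) {v : ValData}
    (hv : ∀ S : Quad, ν (plucker x S) = (v (some S) : WithTop ℚ)) :
    v.IsNormalisedAt (Finset.univ.map s) := by
  choose c hc hxc using hx.exists_frame ν hs
  have hprod : ∀ d : Fin 4 → F, (∀ i, ν (d i) = 0) → ν (∏ i, d i) = 0 := by
    intro d hd
    have := map_prod_eq_coe_sum ν Finset.univ (a := d) (w := fun _ => 0) (by simpa using hd)
    simpa using this
  have hzero : ∀ S : Quad, ν (plucker x S) = 0 → v (some S) = 0 := by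
    intro S h
    rw [hv] at h
    exact_mod_cast h
  refine ⟨fun S => ?_, fun S hS => hzero S ?_, fun i hi => ?_⟩
  · have := map_minorDet_nonneg ν (fun i => (hx i).2.1) (S.1.orderEmbOfFin S.2)
    rw [show minorDet x (S.1.orderEmbOfFin S.2) = plucker x S from rfl, hv] at this
    exact_mod_cast this
  · have h1 : (Finset.univ.map s \ S.1).card = 1 := by
      rw [Finset.card_sdiff_of_subset hS, Finset.card_map, S.2]; rfl
    obtain ⟨y, hy⟩ := Finset.card_eq_one.1 h1
    -- Four of the five frame points omit a single index `a`, and `succAbove` lists the others;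
    -- their determinant is `±1` times scalars of valuation `0`.
    have hy' : y ∈ Finset.univ.map s \ S.1 := by simp [hy]
    rw [Finset.mem_sdiff, Finset.mem_map] at hy'
    obtain ⟨⟨a, -, rfl⟩, hyS⟩ := hy'
    rw [map_plucker_eq ν x S (e := fun j => s (a.succAbove j))
      (s.injective.comp Fin.succAbove_right_injective)]
    · have e : minorDet x (fun j => s (a.succAbove j)) = (∏ j, c (a.succAbove j)) *
          Matrix.det (Matrix.of fun r j => standardFrame F (a.succAbove j) r) := by
        rw [minorDet, ← Matrix.det_mul_row]
        congr 1
        ext r j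
        simp [hxc]
      rw [e, ν.map_mul, hprod _ fun j => hc _, zero_add]
      rcases det_standardFrame (F := F) a with h | h <;> simp [h]
    · intro j
      by_contra hj
      have : s (a.succAbove j) ∈ Finset.univ.map s \ S.1 := by simp [hj]
      rw [hy, Finset.mem_singleton, s.injective.eq_iff] at this
      exact Fin.succAbove_ne a j this
  · obtain ⟨r, hr⟩ := (hx i).2.2
    have hi' : ∀ a, s a ≠ i := by simpa using hi
    -- With `r` a coordinate of valuation `0` of the point `i`, replace the `r`-th basis point by
    -- `i`. By Cramer's rule for the identity matrix, the resulting bracket is that coordinate times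
    -- scalars of valuation `0`.
    let e : Fin 4 → Fin 8 := Function.update (fun j => s j.castSucc) r i
    have her : e r = i := by simp [e]
    have hej : ∀ j, j ≠ r → e j = s j.castSucc := fun j hj => by simp [e, hj]
    have he : Function.Injective e := by
      intro j k hjk
      by_cases hj : j = r <;> by_cases hk : k = r
      · rw [hj, hk]
      · rw [hj, her, hej k hk] at hjk
        exact absurd hjk.symm (hi' _)
      · rw [hk, her, hej j hj] at hjk
        exact absurd hjk (hi' _)
      · rw [hej j hj, hej k hk] at hjk
        exact Fin.castSucc_injective _ (s.injective hjk)
    refine ⟨⟨Finset.univ.image e, by rw [Finset.card_image_of_injective _ he]; rfl⟩,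
      Finset.mem_image.2 ⟨r, by simp, her⟩, ?_, hzero _ ?_⟩
    · intro y hy
      obtain ⟨j, -, rfl⟩ := Finset.mem_image.1 hy
      by_cases hj : j = r
      · rw [hj, her]; simp
      · rw [hej j hj]; simp
    · rw [map_plucker_eq ν x _ he fun j => Finset.mem_image_of_mem _ (Finset.mem_univ j)]
      have e1 : minorDet x e = (∏ j, Function.update (fun j => c j.castSucc) r 1 j) *
          Matrix.det ((1 : Matrix (Fin 4) (Fin 4) F).updateCol r (x i)) := by
        rw [minorDet, ← Matrix.det_mul_row]
        congr 1
        ext t j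
        by_cases hj : j = r
        · subst hj; simp [her]
        · simp [hej j hj, hxc, hj, standardFrame_castSucc]
      rw [e1, ← Matrix.cramer_apply, Matrix.cramer_one, ν.map_mul, hprod]
      · simpa using hr
      · intro j
        by_cases hj : j = r
        · subst hj; simp
        · simp [hj, hc]

/-- Any family of nonzero vectors can be scaled so that the coordinates of each of them have
minimal valuation `0`. -/
theorem exists_scaling {y : Fin 4 → F} (hy : y ≠ 0) :
    ∃ μ : F, μ ≠ 0 ∧ (∀ j, 0 ≤ ν (μ * y j)) ∧ ∃ j, ν (μ * y j) = 0 := by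
  obtain ⟨j, hj⟩ := Finite.exists_min fun j => ν (y j)
  have hyj : y j ≠ 0 := by
    intro h0
    apply hy
    funext k
    have := hj k
    rw [h0, ν.map_zero, top_le_iff, ν.top_iff] at this
    simpa using this
  have h0 : ν ((y j)⁻¹ * y j) = 0 := by rw [inv_mul_cancel₀ hyj, ν.map_one]
  refine ⟨(y j)⁻¹, inv_ne_zero hyj, fun k => ?_, j, h0⟩
  rw [← h0, ν.map_mul, ν.map_mul]
  exact add_le_add le_rfl (hj k)

/-- Valuation data of projectively equivalent octads differ by an affine function. -/
theorem IsValuationData.exists_of_pglEquivalent {O O' : Octad F} (h : PGLEquivalent O O')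
    {v : ValData} (hv : IsValuationData ν O v) (hn : IsNormalised O') :
    ∃ (v' : ValData) (S : Finset (Fin 8)), S.card = 5 ∧ IsValuationData ν O' v' ∧
      v'.IsNormalisedAt S ∧ ValData.AffinelyEquivalent v v' := by
  obtain ⟨g, hg⟩ := h
  obtain ⟨x, hx, hv, ht⟩ := hv
  obtain ⟨s, hs⟩ := hn
  let f : (Fin 4 → F) →ₗ[F] Fin 4 → F := g.1
  let G : Matrix (Fin 4) (Fin 4) F := LinearMap.toMatrix' f
  have hGv : ∀ u, G.mulVec u = g • u := fun u => LinearMap.toMatrix'_mulVec f u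
  have hG : G.det ≠ 0 := by
    have : IsUnit G :=
      (Units.map (LinearMap.toMatrixAlgEquiv' (R := F) (n := Fin 4)).toMonoidHom g).isUnit
    exact ((Matrix.isUnit_iff_isUnit_det G).1 this).ne_zero
  have hy : ∀ i, G.mulVec (x i) ≠ 0 := by
    intro i
    rw [hGv]
    exact (smul_ne_zero_iff_ne g).2 (hx i).1.1
  choose μ hμ hμ1 hμ2 using fun i => exists_scaling ν (hy i)
  obtain ⟨v', h1, h2, h3⟩ := exists_affinelyEquivalent_smul_mulVec ν hv ht hG hμ
  have hx' : IsNormalisedLift ν O' fun i => μ i • G.mulVec (x i) := by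
    intro i
    refine ⟨⟨smul_ne_zero (hμ i) (hy i), ?_⟩, hμ1 i, hμ2 i⟩
    rw [hg, ← (hx i).1.2, Projectivization.smul_mk, Projectivization.mk_eq_mk_iff']
    exact ⟨μ i, by simp only [hGv]⟩
  exact ⟨v', Finset.univ.map s, by simp, ⟨_, hx', h2, h3⟩, hx'.isNormalisedAt ν hs h2, h1⟩

theorem PGLEquivalent.symm {O O' : Octad F} (h : PGLEquivalent O O') : PGLEquivalent O' O := by
  obtain ⟨g, hg⟩ := h
  exact ⟨g⁻¹, fun i => by rw [hg, inv_smul_smul]⟩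

/-- Only the target must be normalised: its frame selects the representative of the affine class. -/
theorem IsPictureOf.of_pglEquivalent {O O' : Octad F} (h : PGLEquivalent O O')
    (hn : IsNormalised O') {p : Picture} (hp : IsPictureOf ν O p) : IsPictureOf ν O' p := by
  obtain ⟨v, B, b, hv, hB, rfl⟩ := hp
  obtain ⟨v', S, hS, hv', hS', hvv'⟩ := hv.exists_of_pglEquivalent ν h hn
  obtain ⟨B', b', hB', e⟩ := hB.exists_of_affinelyEquivalent hS hS' hvv'
  exact ⟨v', B', b', hv', hB', e.symm⟩

end Normalised

end CayleyOctad

/-! ### Invariance of the octad picture -/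

theorem mainTheorem1
    {K : Type*} [Field K] [ValuativeRel K] [TopologicalSpace K] [IsNonarchimedeanLocalField K]
    (hK : ringChar 𝓀[K] ≠ 2)
    {Kbar : Type*} [Field Kbar] [Algebra K Kbar] [IsAlgClosure K Kbar]
    (ν : AddValuation Kbar (WithTop ℚ)) (hν : CayleyOctad.IsNormalisedExtension K ν)
    (O O' : CayleyOctad.Octad Kbar)
    (hO : CayleyOctad.IsCayley O) (hO' : CayleyOctad.IsCayley O')
    (hOn : CayleyOctad.IsNormalised O) (hOn' : CayleyOctad.IsNormalised O')
    (hOO' : CayleyOctad.PGLEquivalent O O') :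
    CayleyOctad.octadPicture ν O = CayleyOctad.octadPicture ν O' ∧
      ∀ p : CayleyOctad.Picture,
        CayleyOctad.IsPictureOf ν O p ↔ CayleyOctad.IsPictureOf ν O' p := by
  have h : ∀ p, CayleyOctad.IsPictureOf ν O p ↔ CayleyOctad.IsPictureOf ν O' p := fun p =>
    ⟨fun hp => hp.of_pglEquivalent ν hOO' hOn', fun hp => hp.of_pglEquivalent ν hOO'.symm hOn⟩
  refine ⟨?_, h⟩
  unfold CayleyOctad.octadPicture
  rw [show CayleyOctad.IsPictureOf ν O = CayleyOctad.IsPictureOf ν O' from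
    funext fun p => propext (h p)]
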